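/- **Conventions.** $\mathbf H$ is a function on $\omega$ such that each $\mathbf H(i)$ is a hereditarily countable set with at least two elements; a larger condition is stronger. $u\vartriangleleft v$ means that $u$ is a proper initial segment of $v$. A function $f:\omega\times\omega\to\omega$ is *fast* if $f(k,\ell)\le f(k,\ell+1)$ and $2f(k,\ell)<f(k+1,\ell)$ for all $k,\ell$. A forcing notion *adds a dominating real* if it forces that some $g\in\omega^\omega$ satisfies $f(n)<g(n)$ for all but finitely many $n$, for every ground model $f\in\omega^\omega$. **Creating pairs and triples.** A *creature* is a triple $t=(\mathrm{nor}[t],\mathrm{val}[t],\mathrm{dis}[t])$, where $\mathrm{nor}[t]\ge 0$ is real, $\mathrm{dis}[t]$ is a hereditarily countable label, and for some $m^t_{dn}<m^t_{up}<\omega$ we have $\emptyset\ne\mathrm{val}[t]\subseteq\{\langle u,v\rangle\in\prod_{i<m^t_{dn}}\mathbf H(i)\times\prod_{i<m^t_{up}}\mathbf H(i):u\vartriangleleft v\}$. We say that $v$ *passes* $t$ if $\langle v{\restriction}m^t_{dn},v{\restriction}m^t_{up}\rangle\in\mathrm{val}[t]$. Creatures $t_0,\dots,t_k$ are *consecutive*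 if $m^{t_i}_{up}=m^{t_{i+1}}_{dn}$ for $i<k$. A *creating pair* $(K,\Sigma)$ consists of a set $K$ of creatures and $\Sigma:[K]^{<\omega}\to\mathcal P(K)$ such that: $\Sigma(\emptyset)=\emptyset$; $t\in\Sigma(t)$; if $\Sigma(\mathcal S)\neq\emptyset$ then $\mathcal S$ can be enumerated consecutively as $t_0,\dots,t_k$ (we write $\Sigma(t_0,\dots,t_k)$); if $s\in\Sigma(t_0,\dots,t_k)$ then $m^s_{dn}=m^{t_0}_{dn}$, $m^s_{up}=m^{t_k}_{up}$, $\mathrm{dom}(\mathrm{val}[s])=\mathrm{dom}(\mathrm{val}[t_0])$, and $v$ passes every $t_i$ for all $\langle u,v\rangle\in\mathrm{val}[s]$; and if $s_i\in\Sigma(\mathcal S_i)$ for $i\le n$ then $\Sigma(s_0,\dots,s_n)\subseteq\Sigma(\bigcup_i\mathcal S_i)$. A *$\otimes$-creating triple* $(K,\Sigma,\Sigma^\bot)$ has in addition a map $\Sigma^\bot$ assigning to each $t\in K$ a family of finite non-empty subsets of $K$, such that: $\{t\}\in\Sigma^\bot(t)$; each $\mathcal S\in\Sigma^\bot(t)$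 can be enumerated consecutively as $s_0,\dots,s_k$, and then $m^{s_0}_{dn}=m^t_{dn}$, $m^{s_k}_{up}=m^t_{up}$, $\mathrm{dom}(\mathrm{val}[t])=\mathrm{dom}(\mathrm{val}[s_0])$, $\mathrm{rng}(\mathrm{val}[s_i])\subseteq\mathrm{dom}(\mathrm{val}[s_{i+1}])$ for $i<k$, and $\langle u,v\rangle\in\mathrm{val}[t]$ whenever $u\in\mathrm{dom}(\mathrm{val}[s_0])$, $u\vartriangleleft v\in\prod_{i<m^t_{up}}\mathbf H(i)$ and $v$ passes every $s_i$; and if $\{s_0,\dots,s_k\}\in\Sigma^\bot(t)$ and $\mathcal S_i\in\Sigma^\bot(s_i)$ for $i\le k$, then $\bigcup_i\mathcal S_i\in\Sigma^\bot(t)$. A creating pair is identified with the triple in which $\Sigma^\bot(t)=\{\{t\}\}$. **Creature forcing.** For consecutive $t_0,\dots,t_n$ let $\mathrm{pos}(w,t_0,\dots,t_n)$ be the set of $v\in\prod_{j<m^{t_n}_{up}}\mathbf H(j)$ with $w\vartriangleleft v$ that pass every $t_i$. A *pre-condition* is a sequence $(w,t_0,t_1,\dots)$ with $t_i\in K$ consecutive,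 $w\in\mathrm{dom}(\mathrm{val}[t_0])$ and $\mathrm{pos}(w,t_0,\dots,t_i)\subseteq\mathrm{dom}(\mathrm{val}[t_{i+1}])$ for all $i$. Write $p\le q$ if the pre-condition $q$ is obtained from $p$ by finitely many operations, each leading from a pre-condition $(w,t_0,t_1,\dots)$ to a pre-condition of the form: $(w^*,t_n,t_{n+1},\dots)$ with $w^*\in\mathrm{pos}(w,t_0,\dots,t_{n-1})$; or $(w,t^*_0,t^*_1,\dots)$ with $t^*_i\in\Sigma(t_{n_i},\dots,t_{n_{i+1}-1})$ for all $i$, for some $0=n_0<n_1<\cdots$; or $(w,t^*_0,t^*_1,\dots)$ with $\{t^*_{n_i},\dots,t^*_{n_{i+1}-1}\}\in\Sigma^\bot(t_i)$ for all $i$, for some $0=n_0<n_1<\cdots$. The forcing notion $\mathbb Q^*_\infty(K,\Sigma,\Sigma^\bot)$ consists of the pre-conditions with $\lim_i\mathrm{nor}[t_i]=\infty$, and $\mathbb Q^*_f(K,\Sigma)$ of those such that for every $n$, $\mathrm{nor}[t_i]\ge f(n,m^{t_i}_{dn})$ for all but finitely many $i$. **Tree forcing.** A *local tree-creature* with node $\eta\in\prod_{i<n}\mathbf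 H(i)$ is a triple $t=(\mathrm{nor}[t],\mathrm{val}[t],\mathrm{dis}[t])$ with $\mathrm{nor}$ and $\mathrm{dis}$ as above and $\emptyset\ne\mathrm{val}[t]\subseteq\{\langle\eta,\nu\rangle:\eta\vartriangleleft\nu\in\prod_{i\le n}\mathbf H(i)\}$; put $\mathrm{pos}(t)=\mathrm{rng}(\mathrm{val}[t])$. A *local tree-creating pair* $(K,\Sigma)$ consists of a set $K$ of local tree-creatures and $\Sigma:K\to\mathcal P(K)$ such that if $s\in\Sigma(t)$ then $s$ has the same node as $t$, $\mathrm{val}[s]\subseteq\mathrm{val}[t]$ and $\Sigma(s)\subseteq\Sigma(t)$. A *tree pre-condition* is a system $\langle t_\eta:\eta\in T\rangle$, where $T\subseteq\bigcup_n\prod_{i<n}\mathbf H(i)$ is a tree with a root (an element of $T$ that is an initial segment of all elements of $T$, all sequences between the root and an element of $T$ being in $T$) and without maximal elements, and each $t_\eta\in K$ has node $\eta$ and $\mathrm{pos}(t_\eta)$ is the set of immediate successors of $\eta$ in $T$. Put $\langle t_\eta:\eta\in T\rangle\le\langle t'_\eta:\eta\in T'\rangle$ if $T'\subseteq T$ and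 $t'_\eta\in\Sigma(t_\eta)$ for all $\eta\in T'$ (every condition being also $\le$ itself). $\mathbb Q^{tree}_1(K,\Sigma)$ consists of the tree pre-conditions for which the norms $\mathrm{nor}[t_\eta]$ tend to $\infty$ along every infinite branch of $T$, and $\mathbb Q^{tree}_f(K,\Sigma)$ of those such that for every $n$ there is $N$ with $\mathrm{nor}[t_\eta]\ge f(n,\mathrm{lh}(\eta))$ for all $\eta\in T$ with $\mathrm{lh}(\eta)\ge N$. **Properties.** Below, $\Sigma(t)$ stands for $\Sigma(\{t\})$ for creating pairs. * $(K,\Sigma)$ is *local* if $m^t_{up}=m^t_{dn}+1$ for all $t\in K$. * *Linked*: if $t_0,t_1\in K$ have the same $m_{dn}$ and the same $m_{up}$ (in the tree case: the same node) and norms $>1$, then some $s\in\Sigma(t_0)\cap\Sigma(t_1)$ has $\mathrm{nor}[s]\ge\min\{\mathrm{nor}[t_0],\mathrm{nor}[t_1]\}-1$. * *Normal*: linked; every $t\in K$ with $\mathrm{nor}[t]\ge3$ has $s\in\Sigma(t)$ with $\mathrm{nor}[t]/2\le\mathrm{nor}[s]\le\mathrm{nor}[t]-1$; and if $s,t\in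 K$, $\mathrm{nor}[s]<\mathrm{nor}[t]$ and $u\in\mathrm{dom}(\mathrm{val}[t])$, then $\langle u,v\rangle\in\mathrm{val}[t]\setminus\mathrm{val}[s]$ for some $v$. * *Semi-normal* (creating pairs): linked, and for all $n\in\omega$ and $t\in K$ with $\mathrm{nor}[t]>2^{n+2}$ and $m^t_{up}-m^t_{dn}>2^{2^{n+4}}$ there are $s_0=t,s_1,\dots,s_n\in K$ such that for each $\ell<n$: $s_{\ell+1}\in\Sigma(s_\ell)$, $2^{n+1-\ell}<\mathrm{nor}[s_{\ell+1}]\le2^{n+2-\ell}$, and whenever $s\in K$, $m^s_{dn}=m^t_{dn}$, $m^s_{up}=m^t_{up}$, $\mathrm{nor}[s]>2^{n+3-\ell}$ and $u\in\mathrm{dom}(\mathrm{val}[s])$, there is $v$ with $\langle u,v\rangle\in\mathrm{val}[s]\setminus\mathrm{val}[s_{\ell+1}]$. * *Gluing*: $\mathrm{dom}(\mathrm{val}[t])=\prod_{i<m^t_{dn}}\mathbf H(i)$ for all $t\in K$, and for each $k$ there is $n_0$ such that for all $n\ge n_0$ and all consecutive $t_0,\dots,t_n\in K$ such that for some $w\in\mathrm{dom}(\mathrm{val}[t_0])$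 we have $\mathrm{pos}(w,t_0,\dots,t_i)\subseteq\mathrm{dom}(\mathrm{val}[t_{i+1}])$ for all $i<n$, there is $s\in\Sigma(t_0,\dots,t_n)$ with $\mathrm{nor}[s]\ge\min\{k,\mathrm{nor}[t_0],\dots,\mathrm{nor}[t_n]\}$. * *Super-gluing*: gluing, and for all $s_0,\dots,s_k\in K$ and $N$ with $m^{s_i}_{up}\le m^{s_{i+1}}_{dn}$ for $i<k$ and $m^{s_k}_{up}\le N$ there is $s\in K$ with $m^s_{dn}=m^{s_0}_{dn}$, $m^s_{up}=N$, $\mathrm{dom}(\mathrm{val}[s])=\mathrm{dom}(\mathrm{val}[s_0])$, $\mathrm{nor}[s]\ge\min_{i\le k}\mathrm{nor}[s_i]-1$, and such that for all $\langle u,v\rangle\in\mathrm{val}[s]$, $v$ passes every $s_i$. * *Cutting property*: for all $t\in K$ with $\mathrm{nor}[t]>1$ and $m^t_{dn}<m<m^t_{up}$ there is $\{s_0,s_1\}\in\Sigma^\bot(t)$ with $m^{s_0}_{dn}=m^t_{dn}$, $m^{s_0}_{up}=m=m^{s_1}_{dn}$, $m^{s_1}_{up}=m^t_{up}$ and $\mathrm{nor}[s_0],\mathrm{nor}[s_1]\ge\min\{\mathrm{nor}[t]-1,m^t_{dn}\}$.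 **Theorem.** 1. Let $f$ be fast. If $(K,\Sigma)$ is a normal local creating pair and $\mathbb Q^*_f(K,\Sigma)\ne\emptyset$, then $\mathbb Q^*_f(K,\Sigma)$ adds a dominating real. If $(K,\Sigma)$ is a normal local tree-creating pair and $\mathbb Q^{tree}_f(K,\Sigma)\neq\emptyset$, then $\mathbb Q^{tree}_f(K,\Sigma)$ adds a dominating real. 2. If $(K,\Sigma)$ is a normal local tree-creating pair and $\mathbb Q^{tree}_1(K,\Sigma)\ne\emptyset$, then $\mathbb Q^{tree}_1(K,\Sigma)$ adds a dominating real. 3. If $(K,\Sigma,\Sigma^\bot)$ is a semi-normal, super-gluing $\otimes$-creating triple with the cutting property and $\mathbb Q^*_\infty(K,\Sigma,\Sigma^\bot)\ne\emptyset$, then $\mathbb Q^*_\infty(K,\Sigma,\Sigma^\bot)$ adds a dominating real. -/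

import Mathlib

open Filter

/-! ### Forcing: names for reals and dominating reals.  Stronger conditions are larger. -/

/-- A (nice) `P`-name for a function from `ℕ` to `ℕ`: the set of all pairs `((n, k), s)` with
`s ∈ decides n k`.  Conditions giving different values at the same argument are incompatible, and
for each `n` the conditions giving some value at `n` are predense, so that the name is forced
to be a total function. -/
structure RealName (P : Type*) [Preorder P] where
  decides : ℕ → ℕ → Set P
  single : ∀ n k k' : ℕ, ∀ s ∈ decides n k, ∀ s' ∈ decides n k',
    (∃ r, s ≤ r ∧ s' ≤ r) → k = k'
  total : ∀ (n : ℕ) (p : P), ∃ k, ∃ s ∈ decides n k, ∃ r, p ≤ r ∧ s ≤ r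

/-- `q ⊩ g(n) ∈ A`: it is dense above `q` that some condition giving `g(n)` a value in `A` is in
the generic filter. -/
def RealName.ForcesMem {P : Type*} [Preorder P] (g : RealName P) (q : P) (n : ℕ) (A : Set ℕ) :
    Prop :=
  ∀ r, q ≤ r → ∃ r', r ≤ r' ∧ ∃ k ∈ A, ∃ s ∈ g.decides n k, s ≤ r'

/-- `q ⊩ (∃ N) (∀ n > N) f(n) < g(n)`, for a ground model function `f`. -/
def RealName.ForcesDominates {P : Type*} [Preorder P] (g : RealName P) (q : P) (f : ℕ → ℕ) :
    Prop :=
  ∀ r, q ≤ r → ∃ r', r ≤ r' ∧ ∃ N, ∀ n, N < n → g.ForcesMem r' n {k | f n < k}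

/-- There is a name for a function in `ℕ → ℕ` which is forced (by every condition) to dominate
every function of the ground model. -/
def AddsDominatingReal (P : Type*) [Preorder P] : Prop :=
  ∃ g : RealName P, ∀ (q : P) (f : ℕ → ℕ), g.ForcesDominates q f

/-! ### Finite sequences -/

/-- The elements of `⋃ n, ∏ i < n, H i`. -/
structure FinSeq (H : ℕ → Type*) where
  len : ℕ
  entry : ∀ i : Fin len, H i

namespace FinSeq

/-- The restriction of `v` to (the indices below) `m`. -/
def restrict {H : ℕ → Type*} (v : FinSeq H) (m : ℕ) : FinSeq H :=
  ⟨min m v.len, fun i => v.entry ⟨i, lt_of_lt_of_le i.2 (min_le_right _ _)⟩⟩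

/-- `u` is an initial segment of `v`. -/
def Init {H : ℕ → Type*} (u v : FinSeq H) : Prop :=
  v.restrict u.len = u

/-- `u` is a proper initial segment of `v`. -/
def ProperInit {H : ℕ → Type*} (u v : FinSeq H) : Prop :=
  u.Init v ∧ u ≠ v

/-- The initial segment of length `k` of an infinite sequence. -/
def ofFun {H : ℕ → Type*} (x : ∀ i, H i) (k : ℕ) : FinSeq H :=
  ⟨k, fun i => x i⟩

end FinSeq

/-! ### Creatures and creating pairs -/

/-- Creatures for `H`; `D` is the type of the values of `dis`, which only serve as labels. -/
structure Creature (H : ℕ → Type*) (D : Type*) where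
  nor : ℝ
  val : Set (FinSeq H × FinSeq H)
  dis : D
  dn : ℕ
  up : ℕ
  nor_nonneg : 0 ≤ nor
  dn_lt_up : dn < up
  val_nonempty : val.Nonempty
  val_sub : ∀ u v, (u, v) ∈ val → u.len = dn ∧ v.len = up ∧ u.ProperInit v

namespace Creature

/-- `dom (val t)`. -/
def dom {H : ℕ → Type*} {D : Type*} (t : Creature H D) : Set (FinSeq H) :=
  {u | ∃ v, (u, v) ∈ t.val}

/-- `rng (val t)`. -/
def rng {H : ℕ → Type*} {D : Type*} (t : Creature H D) : Set (FinSeq H) :=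
  {v | ∃ u, (u, v) ∈ t.val}

/-- `⟨v ↾ m_dn, v ↾ m_up⟩ ∈ val t`. -/
def Allows {H : ℕ → Type*} {D : Type*} (t : Creature H D) (v : FinSeq H) : Prop :=
  (v.restrict t.dn, v.restrict t.up) ∈ t.val

end Creature

/-- `m_up` of `t i` equals `m_dn` of `t (i + 1)`, for consecutive indices in `[a, b)`. -/
def Consecutive {H : ℕ → Type*} {D : Type*} {K : Set (Creature H D)} (t : ℕ → K) (a b : ℕ) :
    Prop :=
  ∀ i, a ≤ i → i + 1 < b → (t i).1.up = (t (i + 1)).1.dn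

open Classical in
/-- The finite set `{t a, …, t (b - 1)}`. -/
noncomputable def block {H : ℕ → Type*} {D : Type*} {K : Set (Creature H D)} (t : ℕ → K)
    (a b : ℕ) : Finset K :=
  (Finset.Ico a b).image t

/-- `pos (w, t 0, …, t n)`. -/
def posSet {H : ℕ → Type*} {D : Type*} {K : Set (Creature H D)} (w : FinSeq H) (t : ℕ → K)
    (n : ℕ) : Set (FinSeq H) :=
  {v | v.len = (t n).1.up ∧ w.ProperInit v ∧ ∀ i ≤ n, (t i).1.Allows v}

open Classical in
/-- Creating pairs `(K, Σ)` for `H`. -/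
structure CreatingPair (H : ℕ → Type*) (D : Type*) where
  K : Set (Creature H D)
  Sig : Finset K → Set K
  sig_enum : ∀ S, (Sig S).Nonempty → ∃ (t : ℕ → K) (k : ℕ),
    S = block t 0 (k + 1) ∧ Consecutive t 0 (k + 1)
  sig_dn_up : ∀ (t : ℕ → K) (k : ℕ), Consecutive t 0 (k + 1) →
    ∀ s ∈ Sig (block t 0 (k + 1)), s.1.dn = (t 0).1.dn ∧ s.1.up = (t k).1.up
  sig_self : ∀ t : K, t ∈ Sig {t}
  sig_empty : Sig ∅ = ∅
  sig_trans : ∀ (A : Finset K) (B : K → Finset K), (∀ s ∈ A, s ∈ Sig (B s)) →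
    Sig A ⊆ Sig (A.biUnion B)
  sig_smooth : ∀ (t : ℕ → K) (k : ℕ), Consecutive t 0 (k + 1) →
    ∀ s ∈ Sig (block t 0 (k + 1)), (t 0).1.dom = s.1.dom ∧
      ∀ u v, (u, v) ∈ s.1.val → ∀ i ≤ k, (t i).1.Allows v

open Classical in
/-- `⊗`-creating triples `(K, Σ, Σ^⊥)` for `H`. -/
structure CreatingTriple (H : ℕ → Type*) (D : Type*) extends CreatingPair H D where
  Dec : K → Set (Finset K)
  dec_enum : ∀ t, ∀ S ∈ Dec t, ∃ (s : ℕ → K) (k : ℕ),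
    S = block s 0 (k + 1) ∧ Consecutive s 0 (k + 1)
  dec_dn_up : ∀ (t : K) (s : ℕ → K) (k : ℕ), Consecutive s 0 (k + 1) →
    block s 0 (k + 1) ∈ Dec t → (s 0).1.dn = t.1.dn ∧ (s k).1.up = t.1.up
  dec_self : ∀ t : K, {t} ∈ Dec t
  dec_trans : ∀ (t : K), ∀ S ∈ Dec t, ∀ B : K → Finset K, (∀ s ∈ S, B s ∈ Dec s) →
    S.biUnion B ∈ Dec t
  dec_smooth : ∀ (t : K) (s : ℕ → K) (k : ℕ), Consecutive s 0 (k + 1) →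
    block s 0 (k + 1) ∈ Dec t →
      t.1.dom = (s 0).1.dom ∧ (∀ i < k, (s i).1.rng ⊆ (s (i + 1)).1.dom) ∧
      ∀ u v, u ∈ (s 0).1.dom → v.len = (s k).1.up → u.ProperInit v →
        (∀ i ≤ k, (s i).1.Allows v) → (u, v) ∈ t.1.val

theorem FinSeq.restrict_of_len {H : ℕ → Type*} (v : FinSeq H) {m : ℕ} (h : v.len = m) :
    v.restrict m = v := by
  subst h
  obtain ⟨n, e⟩ := v
  unfold FinSeq.restrict
  have key : ∀ (m : ℕ) (hm : m = n),
      (⟨m, fun i => e ⟨i, hm ▸ i.2⟩⟩ : FinSeq H) = ⟨n, e⟩ := by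
    rintro m rfl
    rfl
  exact key _ (min_self n)

theorem block_singleton {H : ℕ → Type*} {D : Type*} {K : Set (Creature H D)} {s : ℕ → K}
    {k : ℕ} {t : K} (hs : Consecutive s 0 (k + 1)) (h : block s 0 (k + 1) = {t}) :
    k = 0 ∧ s 0 = t := by
  classical
  have hm : ∀ i, i ≤ k → s i = t := by
    intro i hi
    have : s i ∈ block s 0 (k + 1) :=
      Finset.mem_image_of_mem s (Finset.mem_Ico.2 ⟨Nat.zero_le _, Nat.lt_succ_of_le hi⟩)
    rw [h] at this
    exact Finset.mem_singleton.1 this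
  refine ⟨?_, hm 0 (Nat.zero_le _)⟩
  by_contra hk
  have h1 := hs 0 le_rfl (by omega)
  rw [hm 0 (Nat.zero_le _), hm (0 + 1) (by omega)] at h1
  exact absurd t.1.dn_lt_up (by omega)

/-- A creating pair together with the trivial decomposition operation `Σ^⊥(t) = {{t}}`. -/
def CreatingPair.trivialTriple {H : ℕ → Type*} {D : Type*} (P : CreatingPair H D) :
    CreatingTriple H D where
  toCreatingPair := P
  Dec t := {{t}}
  dec_enum := by
    rintro t S rfl
    refine ⟨fun _ => t, 0, ?_, ?_⟩
    · ext x
      simp [block]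
    · intro i _ hi
      omega
  dec_dn_up := by
    intro t s k hs h
    obtain ⟨rfl, h0⟩ := block_singleton hs h
    rw [h0]
    exact ⟨rfl, rfl⟩
  dec_self t := rfl
  dec_trans := by
    rintro t S rfl B hB
    have := hB t (Finset.mem_singleton_self t)
    simpa using this
  dec_smooth := by
    intro t s k hs h
    obtain ⟨rfl, h0⟩ := block_singleton hs h
    refine ⟨by rw [h0], fun i hi => by omega, ?_⟩
    intro u v hu hv huv hall
    have h1 := hall 0 le_rfl
    rw [h0] at h1 hu hv
    obtain ⟨v', hv'⟩ := hu
    have hl := (t.1.val_sub u v' hv').1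
    unfold Creature.Allows at h1
    rw [FinSeq.restrict_of_len v hv, ← hl, huv.1] at h1
    exact h1

/-! ### The creature forcing notions -/

/-- Sequences `(w, t 0, t 1, …)` satisfying all the demands on a condition except for the norm
condition, that is, the conditions of `Q*_∅(K, Σ, Σ^⊥)`. -/
structure CreatureCond {H : ℕ → Type*} {D : Type*} (P : CreatingTriple H D) where
  w : FinSeq H
  t : ℕ → P.K
  consec : ∀ i, (t i).1.up = (t (i + 1)).1.dn
  w_mem : w ∈ (t 0).1.dom
  pos_sub : ∀ i, posSet w t i ⊆ (t (i + 1)).1.dom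

/-- `Step p q`: `q` is a result of applying one of the three operations to `p`. -/
inductive CreatureCond.Step {H : ℕ → Type*} {D : Type*} {P : CreatingTriple H D} :
    CreatureCond P → CreatureCond P → Prop
  /-- deciding the value -/
  | decide (p q : CreatureCond P) (n : ℕ) (hw : q.w ∈ posSet p.w p.t n)
      (ht : ∀ i, q.t i = p.t (n + 1 + i)) : Step p q
  /-- applying `Σ` -/
  | compose (p q : CreatureCond P) (hw : q.w = p.w) (n : ℕ → ℕ) (h0 : n 0 = 0)
      (hn : StrictMono n)
      (ht : ∀ i, q.t i ∈ P.Sig (block p.t (n i) (n (i + 1)))) : Step p q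
  /-- applying `Σ^⊥` -/
  | decompose (p q : CreatureCond P) (hw : q.w = p.w) (n : ℕ → ℕ) (h0 : n 0 = 0)
      (hn : StrictMono n)
      (ht : ∀ i, block q.t (n i) (n (i + 1)) ∈ P.Dec (p.t i)) : Step p q

/-- `Q*_C(K, Σ, Σ^⊥)` for a norm condition `C`. -/
def CreatureForcing {H : ℕ → Type*} {D : Type*} (P : CreatingTriple H D)
    (C : Set (ℕ → P.K)) : Type _ :=
  {p : CreatureCond P // p.t ∈ C}

/-- `q` is stronger than `p` if it is obtained from `p` by finitely many applications of the
operations; the intermediate results need not satisfy the norm condition. -/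
instance {H : ℕ → Type*} {D : Type*} (P : CreatingTriple H D) (C : Set (ℕ → P.K)) :
    Preorder (CreatureForcing P C) where
  le p q := Relation.ReflTransGen CreatureCond.Step p.1 q.1
  le_refl _ := Relation.ReflTransGen.refl
  le_trans _ _ _ h₁ h₂ := h₁.trans h₂

/-- `Q*_∞(K, Σ, Σ^⊥)`. -/
abbrev QInfty {H : ℕ → Type*} {D : Type*} (P : CreatingTriple H D) : Type _ :=
  CreatureForcing P {t | Tendsto (fun i => (t i).1.nor) atTop atTop}

/-- `Q*_f(K, Σ)`. -/
abbrev QFast {H : ℕ → Type*} {D : Type*} (P : CreatingPair H D) (f : ℕ → ℕ → ℕ) : Type _ :=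
  CreatureForcing P.trivialTriple
    {t | ∀ n, ∀ᶠ i in atTop, (f n (t i).1.dn : ℝ) ≤ (t i).1.nor}

/-- Fast functions `f : ω × ω → ω`. -/
def IsFast (f : ℕ → ℕ → ℕ) : Prop :=
  ∀ k l, f k l ≤ f k (l + 1) ∧ 2 * f k l < f (k + 1) l

/-! ### Properties of creating pairs and triples -/

namespace CreatingPair

def Local {H : ℕ → Type*} {D : Type*} (P : CreatingPair H D) : Prop :=
  ∀ t : P.K, t.1.up = t.1.dn + 1

def Full {H : ℕ → Type*} {D : Type*} (P : CreatingPair H D) : Prop :=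
  ∀ t : P.K, t.1.dom = {u | u.len = t.1.dn}

def Linked {H : ℕ → Type*} {D : Type*} (P : CreatingPair H D) : Prop :=
  ∀ t₀ t₁ : P.K, 1 < t₀.1.nor → 1 < t₁.1.nor → t₀.1.dn = t₁.1.dn → t₀.1.up = t₁.1.up →
    ∃ s, s ∈ P.Sig {t₀} ∩ P.Sig {t₁} ∧ min t₀.1.nor t₁.1.nor - 1 ≤ s.1.nor

def Reducible {H : ℕ → Type*} {D : Type*} (P : CreatingPair H D) : Prop :=
  ∀ t : P.K, 3 ≤ t.1.nor → ∃ s ∈ P.Sig {t}, t.1.nor / 2 ≤ s.1.nor ∧ s.1.nor ≤ t.1.nor - 1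

def Normal {H : ℕ → Type*} {D : Type*} (P : CreatingPair H D) : Prop :=
  P.Reducible ∧ P.Linked ∧
    ∀ s t : P.K, s.1.nor < t.1.nor → ∀ u ∈ t.1.dom, ∃ v, (u, v) ∈ t.1.val \ s.1.val

def SemiNormal {H : ℕ → Type*} {D : Type*} (P : CreatingPair H D) : Prop :=
  P.Linked ∧ ∀ (n : ℕ) (t : P.K), 2 ^ (n + 2) < t.1.nor → 2 ^ 2 ^ (n + 4) < t.1.up - t.1.dn →
    ∃ s : ℕ → P.K, s 0 = t ∧ ∀ l < n,
      s (l + 1) ∈ P.Sig {s l} ∧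
      2 ^ (n + 1 - l) < (s (l + 1)).1.nor ∧ (s (l + 1)).1.nor ≤ 2 ^ (n + 2 - l) ∧
      ∀ r : P.K, r.1.dn = t.1.dn → r.1.up = t.1.up → 2 ^ (n + 3 - l) < r.1.nor →
        ∀ u ∈ r.1.dom, ∃ v, (u, v) ∈ r.1.val \ (s (l + 1)).1.val

/-- `(t 0, …, t n)` is a pure finite candidate. -/
def PFC {H : ℕ → Type*} {D : Type*} (P : CreatingPair H D) (t : ℕ → P.K) (n : ℕ) : Prop :=
  ∃ w ∈ (t 0).1.dom, ∀ i < n,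
    (t i).1.up = (t (i + 1)).1.dn ∧ posSet w t i ⊆ (t (i + 1)).1.dom

/-- The disjunction says that `nor s` is at least the minimum of `k` and all `nor (t i)`. -/
def Gluing {H : ℕ → Type*} {D : Type*} (P : CreatingPair H D) : Prop :=
  P.Full ∧ ∀ k : ℕ, ∃ n₀ : ℕ, ∀ n ≥ n₀, ∀ t : ℕ → P.K, P.PFC t n →
    ∃ s ∈ P.Sig (block t 0 (n + 1)), (k : ℝ) ≤ s.1.nor ∨ ∃ i ≤ n, (t i).1.nor ≤ s.1.nor

/-- The existential in the third line says that `nor s` is at least the minimum of the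
`nor (t i)`, minus 1. -/
def SuperGluing {H : ℕ → Type*} {D : Type*} (P : CreatingPair H D) : Prop :=
  P.Gluing ∧ ∀ (k : ℕ) (t : ℕ → P.K) (N : ℕ),
    (∀ i < k, (t i).1.up ≤ (t (i + 1)).1.dn) → (t k).1.up ≤ N →
      ∃ s : P.K, s.1.dn = (t 0).1.dn ∧ s.1.up = N ∧ s.1.dom = (t 0).1.dom ∧
        (∃ i ≤ k, (t i).1.nor - 1 ≤ s.1.nor) ∧
        ∀ u v, (u, v) ∈ s.1.val → ∀ i ≤ k, (t i).1.Allows v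

end CreatingPair

open Classical in
def CreatingTriple.Cutting {H : ℕ → Type*} {D : Type*} (P : CreatingTriple H D) : Prop :=
  ∀ t : P.K, 1 < t.1.nor → ∀ m : ℕ, t.1.dn < m → m < t.1.up → ∃ s₀ s₁ : P.K,
    s₀.1.dn = t.1.dn ∧ s₀.1.up = m ∧ s₁.1.dn = m ∧ s₁.1.up = t.1.up ∧
    min (t.1.nor - 1) t.1.dn ≤ s₀.1.nor ∧ min (t.1.nor - 1) t.1.dn ≤ s₁.1.nor ∧
    {s₀, s₁} ∈ P.Dec t

/-! ### Local tree-creating pairs and tree forcing notions -/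

/-- Local tree-creatures for `H`; `node` is the unique element of `dom (val t)`. -/
structure TreeCreature (H : ℕ → Type*) (D : Type*) where
  nor : ℝ
  val : Set (FinSeq H × FinSeq H)
  dis : D
  node : FinSeq H
  nor_nonneg : 0 ≤ nor
  val_nonempty : val.Nonempty
  val_sub : ∀ u v, (u, v) ∈ val → u = node ∧ v.len = node.len + 1 ∧ node.ProperInit v

namespace TreeCreature

def dom {H : ℕ → Type*} {D : Type*} (t : TreeCreature H D) : Set (FinSeq H) :=
  {u | ∃ v, (u, v) ∈ t.val}

/-- `pos t = rng (val t)`. -/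
def pos {H : ℕ → Type*} {D : Type*} (t : TreeCreature H D) : Set (FinSeq H) :=
  {v | ∃ u, (u, v) ∈ t.val}

end TreeCreature

/-- Local tree-creating pairs `(K, Σ)` for `H`. -/
structure TreeCreatingPair (H : ℕ → Type*) (D : Type*) where
  K : Set (TreeCreature H D)
  Sig : K → Set K
  sig_node : ∀ t, ∀ s ∈ Sig t, s.1.node = t.1.node
  sig_val : ∀ t, ∀ s ∈ Sig t, s.1.val ⊆ t.1.val
  sig_trans : ∀ t, ∀ s ∈ Sig t, Sig s ⊆ Sig t

namespace TreeCreatingPair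

def Linked {H : ℕ → Type*} {D : Type*} (P : TreeCreatingPair H D) : Prop :=
  ∀ t₀ t₁ : P.K, t₀.1.node = t₁.1.node → 1 < t₀.1.nor → 1 < t₁.1.nor →
    ∃ s, s ∈ P.Sig t₀ ∩ P.Sig t₁ ∧ min t₀.1.nor t₁.1.nor - 1 ≤ s.1.nor

def Reducible {H : ℕ → Type*} {D : Type*} (P : TreeCreatingPair H D) : Prop :=
  ∀ t : P.K, 3 ≤ t.1.nor → ∃ s ∈ P.Sig t, t.1.nor / 2 ≤ s.1.nor ∧ s.1.nor ≤ t.1.nor - 1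

def Normal {H : ℕ → Type*} {D : Type*} (P : TreeCreatingPair H D) : Prop :=
  P.Reducible ∧ P.Linked ∧
    ∀ s t : P.K, s.1.nor < t.1.nor → ∀ u ∈ t.1.dom, ∃ v, (u, v) ∈ t.1.val \ s.1.val

end TreeCreatingPair

/-- Systems `⟨t η : η ∈ T⟩` satisfying all the demands on a tree condition except for the norm
condition. -/
structure TreeCond {H : ℕ → Type*} {D : Type*} (P : TreeCreatingPair H D) where
  T : Set (FinSeq H)
  root : FinSeq H
  root_mem : root ∈ T
  root_init : ∀ ν ∈ T, root.Init ν
  closed : ∀ ν η : FinSeq H, root.Init ν → ν.Init η → η ∈ T → ν ∈ T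
  no_max : ∀ ν ∈ T, ∃ ρ ∈ T, ν.ProperInit ρ
  t : T → P.K
  node_eq : ∀ η : T, (t η).1.node = η
  pos_eq : ∀ η : T, (t η).1.pos =
    {ν | ν ∈ T ∧ η.1.ProperInit ν ∧ ν.len = η.1.len + 1}

namespace TreeCond

/-- Along every branch through `T` the norms diverge to infinity. -/
def NormOne {H : ℕ → Type*} {D : Type*} {P : TreeCreatingPair H D} (p : TreeCond P) : Prop :=
  ∀ (x : ∀ i, H i) (hx : ∀ j, FinSeq.ofFun x (p.root.len + j) ∈ p.T),
    Tendsto (fun j => (p.t ⟨FinSeq.ofFun x (p.root.len + j), hx j⟩).1.nor) atTop atTop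

def NormFast {H : ℕ → Type*} {D : Type*} {P : TreeCreatingPair H D} (f : ℕ → ℕ → ℕ)
    (p : TreeCond P) : Prop :=
  ∀ n, ∃ N, ∀ η : p.T, N ≤ η.1.len → (f n η.1.len : ℝ) ≤ (p.t η).1.nor

/-- `T^q ⊆ T^p` and `t^q η ∈ Σ(t^p η)` for each `η ∈ T^q`. -/
def Extends {H : ℕ → Type*} {D : Type*} {P : TreeCreatingPair H D} (p q : TreeCond P) : Prop :=
  ∃ h : q.T ⊆ p.T, ∀ η : q.T, q.t η ∈ P.Sig (p.t ⟨η.1, h η.2⟩)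

end TreeCond

/-- The tree forcing notion determined by `P` and a norm condition `C`. -/
def TreeForcing {H : ℕ → Type*} {D : Type*} (P : TreeCreatingPair H D)
    (C : Set (TreeCond P)) : Type _ :=
  {p : TreeCond P // p ∈ C}

/-- `q` is stronger than `p` if it extends `p`. The disjunct `p = q` only makes the order
reflexive; it is redundant whenever `t ∈ Σ(t)` for each `t ∈ K`. -/
instance {H : ℕ → Type*} {D : Type*} (P : TreeCreatingPair H D) (C : Set (TreeCond P)) :
    Preorder (TreeForcing P C) where
  le p q := p = q ∨ p.1.Extends q.1
  le_refl _ := Or.inl rfl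
  le_trans p q r h₁ h₂ := by
    rcases h₁ with rfl | ⟨h₁, h₁'⟩
    · exact h₂
    rcases h₂ with rfl | ⟨h₂, h₂'⟩
    · exact Or.inr ⟨h₁, h₁'⟩
    · exact Or.inr ⟨h₂.trans h₁, fun η => P.sig_trans _ _ (h₁' ⟨η.1, h₂ η.2⟩) (h₂' η)⟩

/-- `Q^tree_1(K, Σ)`. -/
abbrev QTreeOne {H : ℕ → Type*} {D : Type*} (P : TreeCreatingPair H D) : Type _ :=
  TreeForcing P {p | p.NormOne}

/-- `Q^tree_f(K, Σ)`. -/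
abbrev QTreeFast {H : ℕ → Type*} {D : Type*} (P : TreeCreatingPair H D) (f : ℕ → ℕ → ℕ) :
    Type _ :=
  TreeForcing P {p | p.NormFast f}

/-!
In each of the four cases the dominating real is read off the generic sequence `x` in
`∏ i, H i`.  At every *position* (a level, a node of the tree, or an interval of a fixed partition)
a chain of creatures `σ 0, σ 1, …` with `val (σ 0) ⊆ val (σ 1) ⊆ …` is fixed in advance, the norm of
`σ n` being about `f (n + 2)`, `3 ^ (n + 2)` or `2 ^ (n + 2)` for all `n` below a bound `N`, which is
as large as the norms at that position permit.  The sequence `x` has an *escape* of index `n` at `m`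
if `n ≤ m`, `n < N` and `x` does not pass the `n`-th creature of the chain at its position of level
`m`; the dominating real maps `n` to the least such `m`.

* Escapes exist: the norms of a condition eventually exceed that of `σ n`, for fixed `n`, and then
  normality provides an extension outside of `σ n`.
* The real dominates `φ`: let `h` tend to infinity so slowly that `m ≤ φ n` implies `h m ≤ n`
  (`exists_slow_inverse`).  Since the pair is linked, the creature of a condition at a position of
  level `m` can be shrunk into `σ (h m)` there.  As `h` tends to infinity, the norms still diverge as
  required.  Afterwards, `x` passes `σ (h m)`, and therefore `σ n` for all `n ≥ h m`; so there
  are no escapes of index `n` at `m ≤ φ n`, for all large `n`.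

`addsDominatingReal_of_branches` reduces the theorem to these two points, by working with the set of
infinite sequences through a condition instead of with the generic filter.  In the local cases the
chains come from repeated halving of norms (`exists_system`).  The
chains serve all conditions at once, not only those above a given one.

For `Q*_∞` the chains come from semi-normality (`CreatingPair.SemiNormal.exists_chain`), and the
creatures of a condition have to be matched with the partition.  Cutting and gluing produce a single
creature on a given interval (`CreatureCond.exists_first`), which is what escaping needs, and a
condition all of whose creatures are on unions of intervals of the partition
(`CreatureCond.exists_aligned`).  In the latter case, super-gluing combines the small creatures on
such a union into one.
-/

/-! ### Dominating reals from branches -/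

/-- A criterion for adding a dominating real.  Every condition `p` comes with a non-empty set `br p`
of branches, which shrinks as `p` grows, and `E x n m` says that the branch `x` has an *escape* of
index `n` at `m`.  The dominating real maps `n` to the first escape of index `n`. -/
theorem addsDominatingReal_of_branches {P X : Type*} [Preorder P] (br : P → Set X)
    (hne : ∀ p, (br p).Nonempty) (hanti : ∀ p q, p ≤ q → br q ⊆ br p) (E : X → ℕ → ℕ → Prop)
    (hdec : ∀ p n, ∃ r, p ≤ r ∧ ∃ k, ∀ x ∈ br r, E x n k ∧
      ∀ y ∈ br r, ∀ m ≤ k, E x n m → E y n m)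
    (hdom : ∀ p (φ : ℕ → ℕ), ∃ r, p ≤ r ∧ ∃ N, ∀ n, N < n → ∀ x ∈ br r, ∀ m, E x n m → φ n < m) :
    AddsDominatingReal P := by
  classical
  have htot : ∀ (n : ℕ) (p : P), ∃ k r, p ≤ r ∧ ∀ x ∈ br r, IsLeast {m | E x n m} k := by
    intro n p
    obtain ⟨r, hpr, k, hk⟩ := hdec p n
    obtain ⟨y, hy⟩ := hne r
    have hex : ∃ m, E y n m := ⟨k, (hk y hy).1⟩
    refine ⟨Nat.find hex, r, hpr, fun x hx => ⟨?_, fun m hm => ?_⟩⟩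
    · exact (hk y hy).2 x hx _ (Nat.find_min' hex (hk y hy).1) (Nat.find_spec hex)
    · rcases le_total m k with hmk | hmk
      · exact Nat.find_min' hex ((hk x hx).2 y hy m hmk hm)
      · exact (Nat.find_min' hex (hk y hy).1).trans hmk
  refine ⟨⟨fun n k => {p | ∀ x ∈ br p, IsLeast {m | E x n m} k}, ?_, ?_⟩, ?_⟩
  · rintro n k k' s hs s' hs' ⟨r, hr, hr'⟩
    obtain ⟨x, hx⟩ := hne r
    exact (hs x (hanti _ _ hr hx)).unique (hs' x (hanti _ _ hr' hx))
  · intro n p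
    obtain ⟨k, r, hpr, hr⟩ := htot n p
    exact ⟨k, r, hr, r, hpr, le_rfl⟩
  · intro q φ r _
    obtain ⟨r', hr', N, hN⟩ := hdom r φ
    refine ⟨r', hr', N, fun n hn r₁ hr₁ => ?_⟩
    obtain ⟨k, r₂, hr₂, hk⟩ := htot n r₁
    obtain ⟨x, hx⟩ := hne r₂
    exact ⟨r₂, hr₂, k, hN n hn x (hanti _ _ (hr₁.trans hr₂) hx) k (hk x hx).1, r₂, hk, le_rfl⟩

/-- A slow inverse of `φ`. -/
theorem exists_slow_inverse (φ : ℕ → ℕ) :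
    ∃ h : ℕ → ℕ, Tendsto h atTop atTop ∧ ∀ n m, m ≤ φ n → h m ≤ n := by
  -- `φ n` itself may be bounded
  have hex : ∀ m, ∃ n, m ≤ φ n + n := fun m => ⟨m, Nat.le_add_left _ _⟩
  refine ⟨fun m => Nat.find (hex m), ?_, fun n m h => Nat.find_min' (hex m) (by omega)⟩
  refine tendsto_atTop.2 fun b => ?_
  have : ∀ j < b, ∀ᶠ m in atTop, φ j + j < m := fun j _ => eventually_gt_atTop _
  filter_upwards [(Filter.eventually_all_finite (Set.finite_Iio b)).2 this] with m hm
  refine (Nat.le_find_iff (hex m) b).2 fun j hj => not_le.2 (hm j hj)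

/-! ### Fast functions -/

theorem IsFast.add_one_le {f : ℕ → ℕ → ℕ} (hf : IsFast f) (k l : ℕ) : f k l + 1 ≤ f (k + 1) l := by
  have := (hf k l).2
  omega

theorem IsFast.mono {f : ℕ → ℕ → ℕ} (hf : IsFast f) (l : ℕ) {k k' : ℕ} (h : k ≤ k') :
    f k l ≤ f k' l :=
  monotone_nat_of_le_succ (f := fun k => f k l)
    (fun k => (Nat.le_succ _).trans (hf.add_one_le k l)) h

theorem IsFast.three_le {f : ℕ → ℕ → ℕ} (hf : IsFast f) (k l : ℕ) : 3 ≤ f (k + 2) l := by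
  have h0 := (hf k l).2
  have h1 := (hf (k + 1) l).2
  have : f (k + 1 + 1) l = f (k + 2) l := rfl
  omega

theorem isFast_three_pow : IsFast fun k _ => 3 ^ k := fun k l => by
  have := Nat.pow_pos (n := k) (show 0 < 3 by norm_num)
  simp only [pow_succ]
  omega

/-! ### Systems of small creatures -/

/-- Repeated halving brings the norm into the interval `[a, 2a)`. -/
theorem exists_reduction {K : Type*} (nor : K → ℝ) (R : K → K → Prop) (hrefl : ∀ t, R t t)
    (htrans : ∀ r s t, R r s → R s t → R r t)
    (hred : ∀ t, 3 ≤ nor t → ∃ s, R s t ∧ nor t / 2 ≤ nor s ∧ nor s ≤ nor t - 1)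
    {a : ℝ} (ha : 3 ≤ 2 * a) (t : K) (ht : a ≤ nor t) :
    ∃ s, R s t ∧ a ≤ nor s ∧ nor s < 2 * a := by
  obtain ⟨k, hk⟩ := exists_nat_gt (nor t - 2 * a)
  induction k generalizing t with
  | zero => exact ⟨t, hrefl t, ht, by push_cast at hk; linarith⟩
  | succ k ih =>
    rcases lt_or_ge (nor t) (2 * a) with h | h
    · exact ⟨t, hrefl t, ht, h⟩
    · obtain ⟨s, hst, h1, h2⟩ := hred t (ha.trans h)
      obtain ⟨r, hrs, hr⟩ := ih s (by linarith) (by push_cast at hk; linarith)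
      exact ⟨r, htrans _ _ _ hrs hst, hr⟩

/-- Below an element of large norm there is a chain whose norms follow `c`. -/
theorem exists_chain {K : Type*} (nor : K → ℝ) (R : K → K → Prop) (hrefl : ∀ t, R t t)
    (htrans : ∀ r s t, R r s → R s t → R r t)
    (hred : ∀ t, 3 ≤ nor t → ∃ s, R s t ∧ nor t / 2 ≤ nor s ∧ nor s ≤ nor t - 1)
    (c : ℕ → ℝ) (hc2 : ∀ n, 2 ≤ c n) (hc : ∀ n, c n ≤ c (n + 1)) (N : ℕ) (t : K)
    (ht : c N ≤ nor t) :
    ∃ σ : ℕ → K, (∀ n, R (σ n) t) ∧ (∀ n n', n ≤ n' → R (σ n) (σ n')) ∧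
      ∀ n ≤ N, c n ≤ nor (σ n) ∧ nor (σ n) < 2 * c n := by
  induction N generalizing t with
  | zero =>
    obtain ⟨s, hst, hs⟩ :=
      exists_reduction nor R hrefl htrans hred (by linarith [hc2 0]) t ht
    refine ⟨fun _ => s, fun _ => hst, fun _ _ _ => hrefl s, fun n hn => ?_⟩
    obtain rfl : n = 0 := by omega
    exact hs
  | succ N ih =>
    obtain ⟨s, hst, hs⟩ :=
      exists_reduction nor R hrefl htrans hred (by linarith [hc2 (N + 1)]) t ht
    obtain ⟨σ, h1, h2, h3⟩ := ih s ((hc N).trans hs.1)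
    refine ⟨fun n => if n ≤ N then σ n else s, fun n => ?_, fun n n' hn => ?_, fun n hn => ?_⟩
    · dsimp only
      split_ifs
      · exact htrans _ _ _ (h1 n) hst
      · exact hst
    · dsimp only
      split_ifs with ha hb
      · exact h2 n n' hn
      · exact h1 n
      · omega
      · exact hrefl s
    · dsimp only
      split_ifs with ha
      · exact h3 n ha
      · obtain rfl : n = N + 1 := by omega
        exact hs

/-- Creatures (elements of `K`) sit at positions in `ι`, and each position has a level.  If norms can
be reduced, then at each position `i` there is an increasing sequence `σ i` whose norms are about
`f (n + 2)`, for those `n` below a bound `N i`; the bound is as large as the norms of the creatures at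
`i` permit, except that only indices up to the level are considered: at a single position the norms
may be unbounded, and then there would be no largest creature to start the chain from. -/
theorem exists_system {ι K α : Type*} [Nonempty K] (pos : K → ι) (lev : ι → ℕ) (nor : K → ℝ)
    (V : K → Set α)
    (hred : ∀ t, 3 ≤ nor t → ∃ s, (pos s = pos t ∧ V s ⊆ V t) ∧
      nor t / 2 ≤ nor s ∧ nor s ≤ nor t - 1)
    {f : ℕ → ℕ → ℕ} (hf : IsFast f) :
    ∃ (N : ι → ℕ) (σ : ι → ℕ → K),
      (∀ i n, n < N i → pos (σ i n) = i ∧ (f (n + 2) (lev i) : ℝ) ≤ nor (σ i n) ∧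
        nor (σ i n) < f (n + 3) (lev i)) ∧
      (∀ i n n', n ≤ n' → V (σ i n) ⊆ V (σ i n')) ∧
      ∀ t n, n ≤ lev (pos t) → (f (n + 2) (lev (pos t)) : ℝ) ≤ nor t → n < N (pos t) := by
  classical
  have key : ∀ i, ∃ (N : ℕ) (σ : ℕ → K),
      (∀ n, n < N → pos (σ n) = i ∧ (f (n + 2) (lev i) : ℝ) ≤ nor (σ n) ∧
        nor (σ n) < f (n + 3) (lev i)) ∧
      (∀ n n', n ≤ n' → V (σ n) ⊆ V (σ n')) ∧
      ∀ t n, pos t = i → n ≤ lev i → (f (n + 2) (lev i) : ℝ) ≤ nor t → n < N := by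
    intro i
    set Q : ℕ → Prop := fun n => ∃ t, pos t = i ∧ (f (n + 2) (lev i) : ℝ) ≤ nor t with hQ
    by_cases h0 : ∃ n ≤ lev i, Q n
    · obtain ⟨n₀, hn₀, hQn₀⟩ := h0
      obtain ⟨t, hti, ht⟩ : Q (Nat.findGreatest Q (lev i)) := Nat.findGreatest_spec hn₀ hQn₀
      obtain ⟨σ, h1, h2, h3⟩ := exists_chain nor (fun s t => pos s = pos t ∧ V s ⊆ V t)
        (fun t => ⟨rfl, subset_rfl⟩) (fun r s t h h' => ⟨h.1.trans h'.1, h.2.trans h'.2⟩) hred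
        (fun n => (f (n + 2) (lev i) : ℝ))
        (fun n => by exact_mod_cast (by omega : 2 ≤ 3).trans (hf.three_le n (lev i)))
        (fun n => by exact_mod_cast hf.mono (lev i) (by omega)) _ t ht
      refine ⟨Nat.findGreatest Q (lev i) + 1, σ, fun n hn => ?_, fun n n' h => (h2 n n' h).2,
        fun t' n ht' hn hnt => ?_⟩
      · have h4 := h3 n (by omega)
        have h5 : (2 * f (n + 2) (lev i) : ℝ) < f (n + 3) (lev i) := by
          exact_mod_cast (hf (n + 2) (lev i)).2
        exact ⟨(h1 n).1.trans hti, h4.1, h4.2.trans h5⟩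
      · exact Nat.lt_succ_of_le (Nat.le_findGreatest hn ⟨t', ht', hnt⟩)
    · exact ⟨0, fun _ => Classical.arbitrary K, fun n hn => absurd hn (by omega),
        fun _ _ _ => subset_rfl, fun t n ht hn hnt => absurd ⟨n, hn, t, ht, hnt⟩ h0⟩
  choose N σ h1 h2 h3 using key
  exact ⟨N, σ, h1, h2, fun t n => h3 _ t n rfl⟩

/-! ### Finite and infinite sequences -/

namespace FinSeq

variable {H : ℕ → Type*}

theorem restrict_ofFun (x : ∀ i, H i) (k m : ℕ) :
    (ofFun x k).restrict m = ofFun x (min m k) := rfl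

theorem len_ofFun (x : ∀ i, H i) (k : ℕ) : (ofFun x k).len = k := rfl

theorem restrict_ofFun_of_le (x : ∀ i, H i) {k m : ℕ} (h : m ≤ k) :
    (ofFun x k).restrict m = ofFun x m := by
  rw [restrict_ofFun, min_eq_left h]

theorem exists_ofFun [∀ i, Nonempty (H i)] (v : FinSeq H) : ∃ x, ofFun x v.len = v := by
  classical
  obtain ⟨n, e⟩ := v
  refine ⟨fun i => if h : i < n then e ⟨i, h⟩ else Classical.arbitrary _, ?_⟩
  simp [ofFun]

theorem ofFun_inj {x y : ∀ i, H i} {k : ℕ} : ofFun x k = ofFun y k ↔ ∀ i < k, x i = y i := by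
  constructor
  · intro h i hi
    simp only [ofFun, mk.injEq, heq_eq_eq, true_and] at h
    exact congrFun h ⟨i, hi⟩
  · intro h
    simp only [ofFun, mk.injEq, heq_eq_eq, true_and]
    exact funext fun i => h i i.2

theorem ofFun_eq_of_le {x y : ∀ i, H i} {k l : ℕ} (h : ofFun x k = ofFun y k) (hl : l ≤ k) :
    ofFun x l = ofFun y l :=
  ofFun_inj.2 fun i hi => ofFun_inj.1 h i (hi.trans_le hl)

theorem Init.len_le {u v : FinSeq H} (h : u.Init v) : u.len ≤ v.len := by
  have := congrArg len h
  exact min_eq_left_iff.1 this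

theorem ProperInit.len_lt {u v : FinSeq H} (h : u.ProperInit v) : u.len < v.len := by
  refine lt_of_le_of_ne h.1.len_le fun hl => h.2 ?_
  have := h.1
  rw [Init, hl, restrict_of_len v rfl] at this
  exact this.symm

theorem Init.properInit {u v : FinSeq H} (h : u.Init v) (hl : u.len < v.len) : u.ProperInit v :=
  ⟨h, fun e => by rw [e] at hl; exact lt_irrefl _ hl⟩

/-- Initial segments of (an initial segment of) `x` are restrictions of `x`. -/
theorem init_ofFun {x : ∀ i, H i} {u : FinSeq H} {k : ℕ} (hk : u.len ≤ k) :
    u.Init (ofFun x k) ↔ ofFun x u.len = u := by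
  rw [Init, restrict_ofFun_of_le x hk]

theorem Init.ofFun_eq {x : ∀ i, H i} {u v : FinSeq H} (h : u.Init v) (hx : ofFun x v.len = v) :
    ofFun x u.len = u := by
  have hl := h.len_le
  rw [← hx] at h
  exact (init_ofFun hl).1 h

theorem ofFun_init_ofFun (x : ∀ i, H i) {k l : ℕ} (h : k ≤ l) : (ofFun x k).Init (ofFun x l) :=
  (init_ofFun h).2 rfl

theorem ofFun_properInit_ofFun (x : ∀ i, H i) {k l : ℕ} (h : k < l) :
    (ofFun x k).ProperInit (ofFun x l) :=
  (ofFun_init_ofFun x h.le).properInit h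

theorem Init.refl (u : FinSeq H) : u.Init u := restrict_of_len u rfl

theorem Init.trans [∀ i, Nonempty (H i)] {u v w : FinSeq H} (h : u.Init v) (h' : v.Init w) :
    u.Init w := by
  obtain ⟨x, hx⟩ := w.exists_ofFun
  rw [← hx] at h' ⊢
  have h1 := (init_ofFun h'.len_le).1 h'
  rw [← h1] at h
  exact (init_ofFun (h.len_le.trans h'.len_le)).2 ((init_ofFun h.len_le).1 h)

/-- An increasing sequence of finite sequences of unbounded length has a limit. -/
theorem exists_limit [∀ i, Nonempty (H i)] (v : ℕ → FinSeq H)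
    (hv : ∀ i, (v i).ProperInit (v (i + 1))) : ∃ x, ∀ i, ofFun x (v i).len = v i := by
  choose y hy using fun i => (v i).exists_ofFun
  have hlen : StrictMono fun i => (v i).len := strictMono_nat_of_lt_succ fun i => (hv i).len_lt
  have hinit : ∀ i j, i ≤ j → (v i).Init (v j) := by
    intro i j hij
    induction j, hij using Nat.le_induction with
    | base => exact Init.refl _
    | succ j _ ih => exact ih.trans (hv j).1
  refine ⟨fun j => y (j + 1) j, fun i => ?_⟩
  conv_rhs => rw [← hy i]
  refine ofFun_inj.2 fun j hj => ?_
  have hj' : j < (v (j + 1)).len := lt_of_lt_of_le (Nat.lt_succ_self j) (hlen.id_le (j + 1))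
  rcases le_total i (j + 1) with h | h
  · exact ofFun_inj.1 (((hinit _ _ h).ofFun_eq (hy _)).trans (hy i).symm) j hj
  · exact (ofFun_inj.1 (((hinit _ _ h).ofFun_eq (hy _)).trans (hy (j + 1)).symm) j hj').symm

end FinSeq

/-! ### Branches of creature conditions -/

/-- The infinite sequence `x` passes `t`. -/
def Creature.Through {H : ℕ → Type*} {D : Type*} (t : Creature H D) (x : ∀ i, H i) : Prop :=
  (FinSeq.ofFun x t.dn, FinSeq.ofFun x t.up) ∈ t.val

namespace Creature

variable {H : ℕ → Type*} {D : Type*} {t : Creature H D} {x y : ∀ i, H i}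

/-- Sequences that are too short are never allowed, so there is no condition on `k`. -/
theorem Allows.through {k : ℕ} (h : t.Allows (FinSeq.ofFun x k)) : t.Through x := by
  have hlen := (t.val_sub _ _ h).2.1
  have hk : t.up ≤ k := min_eq_left_iff.1 hlen
  have hd := t.dn_lt_up
  rwa [Allows, FinSeq.restrict_ofFun_of_le x hk,
    FinSeq.restrict_ofFun_of_le x (hd.le.trans hk)] at h

theorem Allows.through_of_eq {v : FinSeq H} (h : t.Allows v) (hv : FinSeq.ofFun x v.len = v) :
    t.Through x := by
  rw [← hv] at h
  exact h.through

theorem Through.allows (h : t.Through x) {k : ℕ} (hk : t.up ≤ k) :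
    t.Allows (FinSeq.ofFun x k) := by
  rwa [Allows, FinSeq.restrict_ofFun_of_le x hk,
    FinSeq.restrict_ofFun_of_le x (t.dn_lt_up.le.trans hk)]

theorem Through.congr (h : t.Through x) {k : ℕ} (hk : t.up ≤ k)
    (hxy : FinSeq.ofFun x k = FinSeq.ofFun y k) : t.Through y := by
  rwa [Through, ← FinSeq.ofFun_eq_of_le hxy hk,
    ← FinSeq.ofFun_eq_of_le hxy (t.dn_lt_up.le.trans hk)]

theorem Through.mem_dom (h : t.Through x) : FinSeq.ofFun x t.dn ∈ t.dom := ⟨_, h⟩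

theorem through_of_mem_val {u v : FinSeq H} (h : (u, v) ∈ t.val) (hv : FinSeq.ofFun x v.len = v) :
    t.Through x ∧ FinSeq.ofFun x t.dn = u := by
  obtain ⟨h1, h2, h3⟩ := t.val_sub u v h
  have hu := h3.1.ofFun_eq hv
  rw [h1] at hu
  rw [h2] at hv
  refine ⟨?_, hu⟩
  rwa [Through, hu, hv]

end Creature

theorem block_shift {H : ℕ → Type*} {D : Type*} {K : Set (Creature H D)} (t : ℕ → K)
    {a b : ℕ} (h : a < b) : block (fun j => t (a + j)) 0 (b - a - 1 + 1) = block t a b := by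
  ext s
  simp only [block, Finset.mem_image, Finset.mem_Ico]
  constructor
  · rintro ⟨j, hj, rfl⟩
    exact ⟨a + j, by omega, rfl⟩
  · rintro ⟨j, hj, rfl⟩
    exact ⟨j - a, by omega, by rw [Nat.add_sub_cancel' hj.1]⟩

theorem block_succ {H : ℕ → Type*} {D : Type*} {K : Set (Creature H D)} (t : ℕ → K) (a : ℕ) :
    block t a (a + 1) = {t a} := by
  simp [block]

theorem exists_mem_Ico_of_strictMono {n : ℕ → ℕ} (hn : StrictMono n) {j : ℕ} (h0 : n 0 ≤ j) :
    ∃ i, n i ≤ j ∧ j < n (i + 1) := by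
  refine ⟨Nat.findGreatest (fun i => n i ≤ j) j, ?_, ?_⟩
  · exact Nat.findGreatest_spec (P := fun i => n i ≤ j) (Nat.zero_le j) h0
  · by_contra h
    have h1 := not_lt.1 h
    have h2 := Nat.le_findGreatest (P := fun i => n i ≤ j) ((hn.le_apply).trans h1) h1
    exact absurd h2 (Nat.not_succ_le_self _)

namespace CreatingPair

variable {H : ℕ → Type*} {D : Type*} {P : CreatingPair H D} {s t : P.K}

theorem sig_single (h : s ∈ P.Sig {t}) :
    s.1.dn = t.1.dn ∧ s.1.up = t.1.up ∧ s.1.dom = t.1.dom ∧ s.1.val ⊆ t.1.val := by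
  have hb : block (fun _ => t) 0 (0 + 1) = {t} := block_succ _ 0
  have hc : Consecutive (fun _ => t) 0 (0 + 1) := fun i _ hi => by omega
  rw [← hb] at h
  obtain ⟨h1, h2⟩ := P.sig_dn_up _ 0 hc s h
  obtain ⟨h3, h4⟩ := P.sig_smooth _ 0 hc s h
  refine ⟨h1, h2, h3.symm, ?_⟩
  rintro ⟨u, v⟩ huv
  obtain ⟨hu, hv, hi⟩ := s.1.val_sub u v huv
  have h5 := h4 u v huv 0 le_rfl
  rw [Creature.Allows, FinSeq.restrict_of_len v (hv.trans h2), ← h1, ← hu, hi.1] at h5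
  exact h5

end CreatingPair

namespace CreatureCond

variable {H : ℕ → Type*} {D : Type*} {P : CreatingTriple H D}

/-- The infinite sequences through the condition `p`. -/
def branches (p : CreatureCond P) : Set (∀ i, H i) :=
  {x | FinSeq.ofFun x p.w.len = p.w ∧ ∀ i, (p.t i).1.Through x}

variable (p q : CreatureCond P)

theorem w_len : p.w.len = (p.t 0).1.dn := by
  obtain ⟨v, hv⟩ := p.w_mem
  exact ((p.t 0).1.val_sub _ _ hv).1

theorem strictMono_dn : StrictMono fun i => (p.t i).1.dn :=
  strictMono_nat_of_lt_succ fun i => by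
    rw [← p.consec i]
    exact (p.t i).1.dn_lt_up

theorem le_dn (i : ℕ) : i ≤ (p.t i).1.dn := p.strictMono_dn.id_le i

theorem add_dn_le {i j : ℕ} (h : i ≤ j) : (p.t i).1.dn + (j - i) ≤ (p.t j).1.dn := by
  induction j, h using Nat.le_induction with
  | base => simp
  | succ j hj ih =>
    have : (p.t j).1.dn < (p.t (j + 1)).1.dn := p.strictMono_dn (Nat.lt_succ_self j)
    omega

theorem up_le {i j : ℕ} (h : i ≤ j) : (p.t i).1.up ≤ (p.t j).1.up := by
  rw [p.consec i, p.consec j]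
  exact p.strictMono_dn.monotone (Nat.succ_le_succ h)

theorem tendsto_dn : Tendsto (fun i => (p.t i).1.dn) atTop atTop :=
  p.strictMono_dn.tendsto_atTop

variable {p q}

/-- Pasting one more step onto an initial segment of a branch. -/
theorem mem_posSet [∀ i, Nonempty (H i)] {x : ∀ i, H i} {i : ℕ} {v : FinSeq H}
    (hw : FinSeq.ofFun x p.w.len = p.w) (ht : ∀ j < i, (p.t j).1.Through x)
    (hv : (FinSeq.ofFun x (p.t i).1.dn, v) ∈ (p.t i).1.val) : v ∈ posSet p.w p.t i := by
  obtain ⟨y, hy⟩ := v.exists_ofFun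
  obtain ⟨hthr, hxy⟩ := Creature.through_of_mem_val hv hy
  have hlen := ((p.t i).1.val_sub _ _ hv).2.1
  have hw_le : p.w.len ≤ (p.t i).1.dn := by
    rw [p.w_len]
    exact p.strictMono_dn.monotone (Nat.zero_le i)
  have hlt : p.w.len < v.len := by
    rw [hlen]
    exact hw_le.trans_lt (p.t i).1.dn_lt_up
  refine ⟨hlen, FinSeq.Init.properInit ?_ hlt, fun j hj => ?_⟩
  · rw [← hy, FinSeq.init_ofFun hlt.le, FinSeq.ofFun_eq_of_le hxy hw_le, hw]
  · have hup : (p.t j).1.up ≤ v.len := hlen ▸ p.up_le hj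
    rw [← hy]
    rcases hj.eq_or_lt with rfl | hj
    · exact hthr.allows hup
    · have hup' : (p.t j).1.up ≤ (p.t i).1.dn := by
        rw [p.consec j]
        exact p.strictMono_dn.monotone hj
      exact ((ht j hj).congr hup' hxy.symm).allows hup

theorem branches_nonempty [∀ i, Nonempty (H i)] (p : CreatureCond P) : p.branches.Nonempty := by
  -- the sequences in the domain of `p.t i` that extend the stem and pass all earlier creatures
  let S : ℕ → Set (FinSeq H) := fun i => {u | u ∈ (p.t i).1.dom ∧
    ∀ x : ∀ i, H i, FinSeq.ofFun x u.len = u →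
      FinSeq.ofFun x p.w.len = p.w ∧ ∀ j < i, (p.t j).1.Through x}
  have hstep : ∀ i, ∀ u : S i, ∃ v : S (i + 1), (u.1, v.1) ∈ (p.t i).1.val := by
    rintro i ⟨u, ⟨v, huv⟩, hu⟩
    obtain ⟨x, hx⟩ := v.exists_ofFun
    have hux := (Creature.through_of_mem_val huv hx).2
    have hu_len := ((p.t i).1.val_sub _ _ huv).1
    have hux' : FinSeq.ofFun x u.len = u := by rwa [hu_len]
    obtain ⟨hw, hthr⟩ := hu x hux'
    have hpos : v ∈ posSet p.w p.t i := mem_posSet hw hthr (by rwa [hux])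
    refine ⟨⟨v, p.pos_sub i hpos, fun y hy => ⟨hpos.2.1.1.ofFun_eq hy, fun j hj => ?_⟩⟩, huv⟩
    exact (hpos.2.2 j (by omega)).through_of_eq hy
  choose next hnext using hstep
  let v : ∀ i, S i := fun i =>
    Nat.rec ⟨p.w, p.w_mem, fun x hx => ⟨hx, fun j hj => absurd hj (Nat.not_lt_zero j)⟩⟩ next i
  obtain ⟨x, hx⟩ := FinSeq.exists_limit (fun i => (v i).1)
    fun i => ((p.t i).1.val_sub _ _ (hnext i (v i))).2.2
  exact ⟨x, hx 0, fun i => ((v (i + 1)).2.2 x (hx (i + 1))).2 i (Nat.lt_succ_self i)⟩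

theorem Step.branches_subset (h : Step p q) : q.branches ⊆ p.branches := by
  intro x hx
  cases h with
  | decide n hw ht =>
    refine ⟨hw.2.1.1.ofFun_eq hx.1, fun i => ?_⟩
    rcases le_or_gt i n with hi | hi
    · exact (hw.2.2 i hi).through_of_eq hx.1
    · obtain ⟨j, rfl⟩ := Nat.exists_eq_add_of_lt hi
      have := hx.2 j
      rw [ht] at this
      rwa [Nat.add_right_comm]
  | compose hw n h0 hn ht =>
    refine ⟨hw ▸ hx.1, fun j => ?_⟩
    obtain ⟨i, hi, hj⟩ := exists_mem_Ico_of_strictMono hn (h0.trans_le (Nat.zero_le j))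
    have h1 := ht i
    rw [← block_shift p.t (hn (Nat.lt_succ_self i))] at h1
    have hc : Consecutive (fun j => p.t (n i + j)) 0 (n (i + 1) - n i - 1 + 1) :=
      fun j _ _ => p.consec (n i + j)
    have h2 := (P.sig_smooth _ _ hc _ h1).2 _ _ (hx.2 i) (j - n i) (by omega)
    rw [Nat.add_sub_cancel' hi] at h2
    exact h2.through
  | decompose hw n h0 hn ht =>
    refine ⟨hw ▸ hx.1, fun i => ?_⟩
    have h1 := ht i
    rw [← block_shift q.t (hn (Nat.lt_succ_self i))] at h1
    have hc : Consecutive (fun j => q.t (n i + j)) 0 (n (i + 1) - n i - 1 + 1) :=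
      fun j _ _ => q.consec (n i + j)
    obtain ⟨h2, h3⟩ := P.dec_dn_up _ _ _ hc h1
    have h4 := (P.dec_smooth _ _ _ hc h1).2.2 (FinSeq.ofFun x (p.t i).1.dn)
      (FinSeq.ofFun x (p.t i).1.up)
    refine h4 ?_ h3.symm (FinSeq.ofFun_properInit_ofFun x (p.t i).1.dn_lt_up) fun j hj => ?_
    · rw [← h2]
      exact (hx.2 (n i + 0)).mem_dom
    · refine (hx.2 (n i + j)).allows ?_
      rw [← h3]
      exact q.up_le (by omega)

theorem branches_subset_of_reflTransGen (h : Relation.ReflTransGen Step p q) :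
    q.branches ⊆ p.branches := by
  induction h with
  | refl => exact subset_rfl
  | tail _ h ih => exact h.branches_subset.trans ih

/-- The result of deciding the value up to `v`. -/
def decided (p : CreatureCond P) (n : ℕ) (v : FinSeq H) (hv : v ∈ posSet p.w p.t n)
    [∀ i, Nonempty (H i)] : CreatureCond P where
  w := v
  t i := p.t (n + 1 + i)
  consec i := p.consec (n + 1 + i)
  w_mem := p.pos_sub n hv
  pos_sub i := by
    rintro v' ⟨h1, h2, h3⟩
    refine p.pos_sub (n + 1 + i) ⟨h1, ?_, fun j hj => ?_⟩
    · exact (hv.2.1.1.trans h2.1).properInit (hv.2.1.len_lt.trans h2.len_lt)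
    · rcases le_or_gt j n with hj' | hj'
      · obtain ⟨x, hx⟩ := v'.exists_ofFun
        have hxv := h2.1.ofFun_eq hx
        rw [← hx]
        refine ((hv.2.2 j hj').through_of_eq hxv).allows ?_
        rw [h1]
        exact p.up_le hj
      · obtain ⟨k, rfl⟩ := Nat.exists_eq_add_of_lt hj'
        have := h3 k (by omega)
        rwa [Nat.add_right_comm]

theorem step_decided [∀ i, Nonempty (H i)] (p : CreatureCond P) (n : ℕ) (v : FinSeq H)
    (hv : v ∈ posSet p.w p.t n) : Step p (p.decided n v hv) :=
  .decide p _ n hv fun _ => rfl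

/-- Shrinking every creature of a condition separately. -/
theorem exists_shrink (p : CreatureCond P) (t : ℕ → P.K) (ht : ∀ i, t i ∈ P.Sig {p.t i}) :
    ∃ q : CreatureCond P, q.t = t ∧ Step p q := by
  have hs := fun i => CreatingPair.sig_single (ht i)
  let q : CreatureCond P :=
    { w := p.w
      t := t
      consec := fun i => by rw [(hs i).2.1, (hs (i + 1)).1, p.consec]
      w_mem := by
        rw [(hs 0).2.2.1]
        exact p.w_mem
      pos_sub := fun i v hv => by
        rw [(hs (i + 1)).2.2.1]
        refine p.pos_sub i ⟨hv.1.trans (hs i).2.1, hv.2.1, fun j hj => ?_⟩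
        have := hv.2.2 j hj
        rw [Creature.Allows, (hs j).1, (hs j).2.1] at this
        exact (hs j).2.2.2 this }
  refine ⟨q, rfl, .compose p q rfl id rfl strictMono_id fun i => ?_⟩
  rw [id, id, block_succ]
  exact ht i

end CreatureCond

/-! ### Local creating pairs -/

/-- The escape of index `n` at `m` is the failure of a branch to pass the `n`-th creature of a
system at level `m`.  Linkedness lets a condition avoid escapes up to `φ n`, for all large `n`, by
shrinking its creature at level `m` into the creature with index `h m`, for a slow inverse `h`
of `φ`; the last clause of normality makes it possible to escape. -/
theorem addsDominatingReal_qFast {H : ℕ → Type*} {D : Type*} [∀ i, Nonempty (H i)]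
    {f : ℕ → ℕ → ℕ} (hf : IsFast f) (P : CreatingPair H D) (hloc : P.Local) (hnorm : P.Normal)
    (hne : Nonempty (QFast P f)) : AddsDominatingReal (QFast P f) := by
  obtain ⟨hred, hlink, hesc⟩ := hnorm
  obtain ⟨p₀⟩ := hne
  have : Nonempty P.K := ⟨p₀.1.t 0⟩
  obtain ⟨N, σ, hσ, hσmono, hN⟩ := exists_system (fun t : P.K => t.1.dn) id (fun t => t.1.nor)
    (fun t => t.1.val) (fun t ht => by
      obtain ⟨s, hs, h⟩ := hred t ht
      exact ⟨s, ⟨(CreatingPair.sig_single hs).1, (CreatingPair.sig_single hs).2.2.2⟩, h⟩) hf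
  simp only [id] at hσ hN
  refine addsDominatingReal_of_branches (fun p => p.1.branches) (fun p => p.1.branches_nonempty)
    (fun p q hpq => CreatureCond.branches_subset_of_reflTransGen hpq)
    (fun x n m => n ≤ m ∧ n < N m ∧ (FinSeq.ofFun x m, FinSeq.ofFun x (m + 1)) ∉ (σ m n).1.val)
    ?_ ?_
  · rintro ⟨p, hp⟩ n
    -- `σ _ n` has norm less than `f (n + 3)`
    obtain ⟨i, hi, hni⟩ := ((hp (n + 3)).and (eventually_ge_atTop n)).exists
    have hnm := hni.trans (p.le_dn i)
    have hnN : n < N (p.t i).1.dn := hN _ n hnm (le_trans (by exact_mod_cast hf.mono _ (by omega)) hi)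
    obtain ⟨x, hx⟩ := p.branches_nonempty
    obtain ⟨v, hv, hv'⟩ := hesc _ (p.t i) ((hσ _ _ hnN).2.2.trans_le hi) _ (hx.2 i).mem_dom
    have hvlen : v.len = (p.t i).1.dn + 1 := ((p.t i).1.val_sub _ _ hv).2.1.trans (hloc _)
    have hpos := CreatureCond.mem_posSet hx.1 (fun j _ => hx.2 j) hv
    refine ⟨⟨p.decided i v hpos, fun k => ?_⟩, .single (p.step_decided i v hpos), (p.t i).1.dn,
      fun y hy => ⟨⟨hnm, hnN, ?_⟩, fun z hz m hm => ?_⟩⟩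
    · exact (tendsto_add_atTop_nat (i + 1)).eventually (hp k) |>.mono fun j hj => by
        simpa [CreatureCond.decided, add_comm] using hj
    · have hyv : FinSeq.ofFun y v.len = v := hy.1
      rw [(Creature.through_of_mem_val hv hyv).2, ← hvlen, hyv]
      exact hv'
    · have hyz : FinSeq.ofFun y v.len = FinSeq.ofFun z v.len := hy.1.trans hz.1.symm
      rw [FinSeq.ofFun_eq_of_le hyz (by omega : m + 1 ≤ v.len),
        FinSeq.ofFun_eq_of_le hyz (by omega : m ≤ v.len)]
      exact id
  · rintro ⟨p, hp⟩ φ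
    obtain ⟨h, hh, hφ⟩ := exists_slow_inverse φ
    have hex : ∀ i, ∃ s ∈ P.Sig {p.t i},
        (h (p.t i).1.dn < N (p.t i).1.dn → 1 < (p.t i).1.nor →
          s ∈ P.Sig {σ (p.t i).1.dn (h (p.t i).1.dn)}) ∧
        min (p.t i).1.nor (f (h (p.t i).1.dn + 2) (p.t i).1.dn) - 1 ≤ s.1.nor := by
      intro i
      by_cases hc : h (p.t i).1.dn < N (p.t i).1.dn ∧ 1 < (p.t i).1.nor
      · obtain ⟨h1, h2, -⟩ := hσ _ _ hc.1
        have h3 := hf.three_le (h (p.t i).1.dn) (p.t i).1.dn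
        have h4 : (3 : ℝ) ≤ f (h (p.t i).1.dn + 2) (p.t i).1.dn := by exact_mod_cast h3
        obtain ⟨s, hs, hsn⟩ := hlink (p.t i) _ hc.2 (by linarith) h1.symm
          ((hloc (p.t i)).trans (by rw [hloc, h1]))
        exact ⟨s, hs.1, fun _ _ => hs.2, le_trans (by gcongr) hsn⟩
      · refine ⟨p.t i, P.sig_self _, fun h1 h2 => absurd ⟨h1, h2⟩ hc, ?_⟩
        linarith [min_le_left (p.t i).1.nor (f (h (p.t i).1.dn + 2) (p.t i).1.dn : ℝ)]
    choose t ht ht' htn using hex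
    obtain ⟨q, hq, hpq⟩ := p.exists_shrink t ht
    have hdn : ∀ i, (t i).1.dn = (p.t i).1.dn := fun i => (CreatingPair.sig_single (ht i)).1
    obtain ⟨i₀, hi₀⟩ := eventually_atTop.1 (hp 2)
    refine ⟨⟨q, fun n => ?_⟩, .single hpq, (p.t i₀).1.dn, fun n hn x hx m hm => ?_⟩
    · rw [hq]
      filter_upwards [hp (n + 1), (hh.comp p.tendsto_dn).eventually_ge_atTop n] with i hi hhi
      have h1 : (f n (p.t i).1.dn : ℝ) + 1 ≤ f (n + 1) (p.t i).1.dn := by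
        exact_mod_cast hf.add_one_le n _
      have h2 : (f (n + 1) (p.t i).1.dn : ℝ) ≤ f (h (p.t i).1.dn + 2) (p.t i).1.dn := by
        have hhi' : n ≤ h (p.t i).1.dn := hhi
        exact_mod_cast hf.mono _ (by omega)
      have h3 := le_min hi h2
      rw [hdn]
      linarith [htn i, le_min hi h2]
    · obtain ⟨hnm, hnN, hmem⟩ := hm
      by_contra hle
      have hhm := hφ n m (not_lt.1 hle)
      -- the levels of a local condition are all the numbers from the length of its stem on
      have hloc' : ∀ j, (p.t j).1.up = (p.t j).1.dn + 1 := fun j => hloc (p.t j)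
      have hlev : ∀ j, (p.t j).1.dn = (p.t 0).1.dn + j := by
        intro j
        induction j with
        | zero => rfl
        | succ j ih => rw [← p.consec, hloc', ih, Nat.add_assoc]
      have h0 := hlev i₀
      obtain ⟨i, rfl⟩ : ∃ i, m = (p.t i).1.dn :=
        ⟨m - (p.t 0).1.dn, by rw [hlev]; omega⟩
      have hi : i₀ ≤ i := by
        have h1 := hlev i
        omega
      have h1 : (1 : ℝ) < (p.t i).1.nor := by
        have := hi₀ i hi
        have h3 : (3 : ℝ) ≤ f 2 (p.t i).1.dn := by exact_mod_cast hf.three_le 0 _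
        linarith
      have h2 := (CreatingPair.sig_single (ht' i (by omega) h1)).2.2.2
      have h3 := hx.2 i
      rw [hq, Creature.Through, hloc, hdn] at h3
      exact hmem (hσmono _ _ _ hhm (h2 h3))

/-! ### Branches of tree conditions -/

namespace TreeCond

variable {H : ℕ → Type*} {D : Type*} {P : TreeCreatingPair H D}

/-- The infinite branches of the tree of `p`. -/
def branches (p : TreeCond P) : Set (∀ i, H i) :=
  {x | ∀ j, p.root.len ≤ j → FinSeq.ofFun x j ∈ p.T}

theorem ofFun_root_len {p : TreeCond P} {x : ∀ i, H i} (hx : x ∈ p.branches) :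
    FinSeq.ofFun x p.root.len = p.root :=
  (FinSeq.init_ofFun le_rfl).1 (p.root_init _ (hx _ le_rfl))

theorem mem_branches (p : TreeCond P) {x : ∀ i, H i}
    (hx : ∀ k, ∃ j, k ≤ j ∧ FinSeq.ofFun x j ∈ p.T) : x ∈ p.branches := by
  intro k hk
  obtain ⟨j, hkj, hj⟩ := hx k
  refine p.closed _ _ ?_ (FinSeq.ofFun_init_ofFun x hkj) hj
  have h := p.root_init _ hj
  exact (FinSeq.init_ofFun hk).2 ((FinSeq.init_ofFun h.len_le).1 h)

theorem mem_val_of_mem_branches {p : TreeCond P} {x : ∀ i, H i} (hx : x ∈ p.branches) {j : ℕ}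
    (hj : p.root.len ≤ j) :
    (FinSeq.ofFun x j, FinSeq.ofFun x (j + 1)) ∈ (p.t ⟨_, hx j hj⟩).1.val := by
  have h : FinSeq.ofFun x (j + 1) ∈ (p.t ⟨_, hx j hj⟩).1.pos := by
    rw [p.pos_eq]
    exact ⟨hx _ (by omega), FinSeq.ofFun_properInit_ofFun x (Nat.lt_succ_self j), rfl⟩
  obtain ⟨u, hu⟩ := h
  obtain rfl : u = FinSeq.ofFun x j :=
    ((TreeCreature.val_sub _ _ _ hu).1).trans (p.node_eq ⟨_, hx j hj⟩)
  exact hu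

theorem Extends.branches_subset {p q : TreeCond P} (h : p.Extends q) : q.branches ⊆ p.branches :=
  fun _ hx => p.mem_branches fun k =>
    ⟨max k q.root.len, le_max_left _ _, h.1 (hx _ (le_max_right _ _))⟩

variable [∀ i, Nonempty (H i)]

/-- Increasing sequences of nodes give branches. -/
theorem exists_branch (p : TreeCond P) (v : ℕ → FinSeq H) (hv : ∀ i, v i ∈ p.T)
    (hlt : ∀ i, (v i).ProperInit (v (i + 1))) :
    ∃ x ∈ p.branches, ∀ i, FinSeq.ofFun x (v i).len = v i := by
  obtain ⟨x, hx⟩ := FinSeq.exists_limit v hlt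
  have hlen : StrictMono fun i => (v i).len := strictMono_nat_of_lt_succ fun i => (hlt i).len_lt
  exact ⟨x, p.mem_branches fun k => ⟨_, hlen.le_apply, (hx k).symm ▸ hv k⟩, hx⟩

theorem branches_nonempty (p : TreeCond P) : p.branches.Nonempty := by
  choose g hg hlt using p.no_max
  let v : ℕ → p.T := fun i => Nat.rec ⟨p.root, p.root_mem⟩ (fun _ η => ⟨g η.1 η.2, hg _ _⟩) i
  obtain ⟨x, hx, -⟩ := p.exists_branch (fun i => (v i).1) (fun i => (v i).2) fun i => hlt _ (v i).2
  exact ⟨x, hx⟩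

/-- A condition above `p` with root `η₀` whose creatures are given by `c`. -/
theorem exists_subtree (p : TreeCond P) {η₀ : FinSeq H} (h₀ : η₀ ∈ p.T) (c : FinSeq H → P.K)
    (hc : ∀ η (h : η ∈ p.T), η₀.Init η → c η ∈ P.Sig (p.t ⟨η, h⟩)) :
    ∃ q : TreeCond P, p.Extends q ∧ q.root = η₀ ∧ ∀ η : q.T, q.t η = c η := by
  have hnode : ∀ η, η ∈ p.T → η₀.Init η → (c η).1.node = η := fun η h hi =>
    (P.sig_node _ _ (hc η h hi)).trans (p.node_eq ⟨η, h⟩)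
  let T : Set (FinSeq H) := {η | η ∈ p.T ∧ η₀.Init η ∧
    ∀ k, η₀.len ≤ k → k < η.len → (η.restrict k, η.restrict (k + 1)) ∈ (c (η.restrict k)).1.val}
  -- successors with respect to `c` stay in the tree
  have hsucc : ∀ η ∈ T, ∀ ν, (η, ν) ∈ (c η).1.val → ν ∈ T := by
    rintro η ⟨hη, hi, hval⟩ ν hν
    obtain ⟨-, hlen, hlt⟩ := (c η).1.val_sub _ _ hν
    rw [hnode η hη hi] at hlen hlt
    have hνT : ν ∈ (p.t ⟨η, hη⟩).1.pos := ⟨η, P.sig_val _ _ (hc η hη hi) hν⟩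
    rw [p.pos_eq] at hνT
    refine ⟨hνT.1, hi.trans hlt.1, fun k hk hk' => ?_⟩
    obtain ⟨x, hx⟩ := ν.exists_ofFun
    have hxη := hlt.1.ofFun_eq hx
    have hr : ∀ l ≤ η.len, ν.restrict l = η.restrict l := fun l hl => by
      conv_lhs => rw [← hx]
      conv_rhs => rw [← hxη]
      rw [FinSeq.restrict_ofFun_of_le _ hl, FinSeq.restrict_ofFun_of_le _ (by omega)]
    rcases (show k ≤ η.len by omega).lt_or_eq with h | rfl
    · rw [hr k h.le, hr (k + 1) h]
      exact hval k hk h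
    · rw [hr _ le_rfl, FinSeq.restrict_of_len η rfl, FinSeq.restrict_of_len ν hlen]
      exact hν
  let q : TreeCond P :=
    { T := T
      root := η₀
      root_mem := ⟨h₀, FinSeq.Init.refl _, fun k hk hk' => by omega⟩
      root_init := fun ν hν => hν.2.1
      closed := by
        rintro ν η h1 h2 ⟨hη, hi, hval⟩
        refine ⟨p.closed _ _ ((p.root_init _ h₀).trans h1) h2 hη, h1, fun k hk hk' => ?_⟩
        obtain ⟨x, hx⟩ := η.exists_ofFun
        have hxν := h2.ofFun_eq hx
        have hle := h2.len_le
        have := hval k hk (by omega)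
        rw [← hx, FinSeq.restrict_ofFun_of_le _ (by omega),
          FinSeq.restrict_ofFun_of_le _ (by omega)] at this
        rwa [← hxν, FinSeq.restrict_ofFun_of_le _ (by omega),
          FinSeq.restrict_ofFun_of_le _ (by omega)]
      no_max := by
        intro η hη
        obtain ⟨⟨u, ν⟩, hν⟩ := (c η).1.val_nonempty
        obtain ⟨hu, hlen, hlt⟩ := (c η).1.val_sub _ _ hν
        rw [hnode η hη.1 hη.2.1] at hu hlt
        exact ⟨ν, hsucc η hη ν (hu ▸ hν), hlt⟩
      t := fun η => c η
      node_eq := fun η => hnode _ η.2.1 η.2.2.1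
      pos_eq := by
        rintro ⟨η, hη⟩
        ext ν
        constructor
        · rintro ⟨u, hν⟩
          obtain ⟨hu, hlen, hlt⟩ := (c η).1.val_sub _ _ hν
          rw [hnode η hη.1 hη.2.1] at hu hlt hlen
          exact ⟨hsucc η hη ν (hu ▸ hν), hlt, hlen⟩
        · rintro ⟨⟨-, -, hval⟩, hlt, hlen⟩
          dsimp only at hlt hlen
          have := hval η.len hη.2.1.len_le hlt.len_lt
          rw [hlt.1, FinSeq.restrict_of_len ν hlen] at this
          exact ⟨η, this⟩ }
  exact ⟨q, ⟨fun η hη => hη.1, fun η => hc _ η.2.1 η.2.2.1⟩, rfl, fun η => rfl⟩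

/-- The `n`-th norm bound given by `f` holds from some point on along each branch of `p`. -/
def Diverges (f : ℕ → ℕ → ℕ) (p : TreeCond P) : Prop :=
  ∀ x ∈ p.branches, ∀ n, ∀ᶠ j in atTop, ∀ h : FinSeq.ofFun x j ∈ p.T,
    (f n j : ℝ) ≤ (p.t ⟨_, h⟩).1.nor

/-- If the bound fails at a node above every node, then it fails cofinally along some branch. -/
theorem Diverges.exists_node {f : ℕ → ℕ → ℕ} {p : TreeCond P} (hp : p.Diverges f) (n L : ℕ) :
    ∃ η₀ ∈ p.T, L ≤ η₀.len ∧
      ∀ η (h : η ∈ p.T), η₀.Init η → (f n η.len : ℝ) ≤ (p.t ⟨η, h⟩).1.nor := by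
  by_contra! hcon
  let B : Set (FinSeq H) := {η | L ≤ η.len ∧ ∃ h : η ∈ p.T, (p.t ⟨η, h⟩).1.nor < f n η.len}
  have hB : ∀ η₀ ∈ p.T, L ≤ η₀.len → ∃ η : B, η₀.Init η.1 := by
    intro η₀ h₀ hL
    obtain ⟨η, hη, hi, hlt⟩ := hcon η₀ h₀ hL
    exact ⟨⟨η, hL.trans hi.len_le, hη, hlt⟩, hi⟩
  obtain ⟨x, hx⟩ := p.branches_nonempty
  obtain ⟨η₀, -⟩ := hB (FinSeq.ofFun x (max L p.root.len)) (hx _ (le_max_right _ _))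
    (le_max_left _ _)
  have hnext : ∀ η : B, ∃ ν : B, η.1.ProperInit ν.1 := by
    rintro ⟨η, hL, hη, -⟩
    obtain ⟨ρ, hρ, hlt⟩ := p.no_max η hη
    obtain ⟨ν, hν⟩ := hB ρ hρ (hL.trans hlt.len_lt.le)
    exact ⟨ν, (hlt.1.trans hν).properInit (hlt.len_lt.trans_le hν.len_le)⟩
  choose next hnext using hnext
  let v : ℕ → B := fun i => Nat.rec η₀ (fun _ => next) i
  obtain ⟨y, hy, hyv⟩ := p.exists_branch (fun i => (v i).1) (fun i => (v i).2.2.1)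
    fun i => hnext (v i)
  have hlen : StrictMono fun i => (v i).1.len :=
    strictMono_nat_of_lt_succ fun i => (hnext (v i)).len_lt
  obtain ⟨i, hi⟩ := (hlen.tendsto_atTop.eventually (hp y hy n)).exists
  obtain ⟨h, hlt⟩ := (v i).2.2
  have h1 : ∀ η, η = (v i).1 → ∀ h' : η ∈ p.T, ¬ (f n (v i).1.len : ℝ) ≤ (p.t ⟨η, h'⟩).1.nor := by
    rintro _ rfl h'
    exact not_le.2 hlt
  exact h1 _ (hyv i) ((hyv i).symm ▸ h) (hi _)

end TreeCond

/-! ### Local tree-creating pairs -/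

/-- As for local creating pairs, with nodes in place of levels.  The norm condition `C` is only used
through two facts: the norms grow along branches, and decreasing them as linkedness does leads to
conditions again. -/
theorem addsDominatingReal_treeForcing {H : ℕ → Type*} {D : Type*} [∀ i, Nonempty (H i)]
    {f : ℕ → ℕ → ℕ} (hf : IsFast f) (P : TreeCreatingPair H D) (hnorm : P.Normal)
    (C : Set (TreeCond P)) (hdiv : ∀ p ∈ C, p.Diverges f)
    (hC : ∀ p ∈ C, ∀ q : TreeCond P, ∀ hpq : p.Extends q, ∀ h : ℕ → ℕ, Tendsto h atTop atTop →
      (∀ η : q.T, min (p.t ⟨η, hpq.1 η.2⟩).1.nor (f (h η.1.len) η.1.len) - 1 ≤ (q.t η).1.nor) →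
      q ∈ C)
    (hne : Nonempty (TreeForcing P C)) : AddsDominatingReal (TreeForcing P C) := by
  classical
  obtain ⟨hred, hlink, hesc⟩ := hnorm
  obtain ⟨p₀⟩ := hne
  have : Nonempty P.K := ⟨p₀.1.t ⟨_, p₀.1.root_mem⟩⟩
  obtain ⟨N, σ, hσ, hσmono, hN⟩ := exists_system (fun t : P.K => t.1.node) FinSeq.len
    (fun t => t.1.nor) (fun t => t.1.val) (fun t ht => by
      obtain ⟨s, hs, h⟩ := hred t ht
      exact ⟨s, ⟨P.sig_node _ _ hs, P.sig_val _ _ hs⟩, h⟩) hf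
  -- every condition can be shrunk above each node above which all its norms exceed `1`
  have hshrink : ∀ p ∈ C, ∀ η₀ ∈ p.T,
      (∀ η (h : η ∈ p.T), η₀.Init η → (1 : ℝ) < (p.t ⟨η, h⟩).1.nor) →
      ∀ h : ℕ → ℕ, Tendsto h atTop atTop → ∃ q ∈ C, p.Extends q ∧ q.root = η₀ ∧
        ∀ η : q.T, h η.1.len < N η → (q.t η).1.val ⊆ (σ η (h η.1.len)).1.val := by
    intro p hp η₀ h₀ hbig h hh
    -- a shrunken creature is needed even where there is nothing to avoid, as `t ∈ Σ(t)` is not assumed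
    have hex : ∀ η, ∃ s : P.K, ∀ hη : η ∈ p.T, η₀.Init η → s ∈ P.Sig (p.t ⟨η, hη⟩) ∧
        (h η.len < N η → s.1.val ⊆ (σ η (h η.len)).1.val) ∧
        min (p.t ⟨η, hη⟩).1.nor (f (h η.len) η.len) - 1 ≤ s.1.nor := by
      intro η
      by_cases hη : η ∈ p.T ∧ η₀.Init η
      swap
      · exact ⟨Classical.arbitrary _, fun h1 h2 => absurd ⟨h1, h2⟩ hη⟩
      obtain ⟨hη, hi⟩ := hη
      have h1 := hbig η hη hi
      by_cases hc : h η.len < N η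
      · obtain ⟨h2, h3, -⟩ := hσ η _ hc
        have h4 : (3 : ℝ) ≤ f (h η.len + 2) η.len := by exact_mod_cast hf.three_le _ _
        have h5 : (f (h η.len) η.len : ℝ) ≤ f (h η.len + 2) η.len := by
          exact_mod_cast hf.mono _ (by omega)
        obtain ⟨s, hs, hsn⟩ := hlink (p.t ⟨η, hη⟩) (σ η (h η.len)) ((p.node_eq _).trans h2.symm)
          h1 (by linarith)
        refine ⟨s, fun _ _ => ⟨hs.1, fun _ => P.sig_val _ _ hs.2, le_trans ?_ hsn⟩⟩
        gcongr
        exact h5.trans h3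
      · obtain ⟨s, hs, hsn⟩ := hlink (p.t ⟨η, hη⟩) (p.t ⟨η, hη⟩) rfl h1 h1
        refine ⟨s, fun _ _ => ⟨hs.1, fun h => absurd h hc, le_trans ?_ hsn⟩⟩
        rw [min_self]
        gcongr
        exact min_le_left _ _
    choose c hc using hex
    obtain ⟨q, hpq, hroot, hqt⟩ := p.exists_subtree h₀ c fun η hη hi => (hc η hη hi).1
    have hi : ∀ η : q.T, η₀.Init η := fun η => hroot ▸ q.root_init _ η.2
    refine ⟨q, hC p hp q hpq h hh fun η => ?_, hpq, hroot, fun η hη => ?_⟩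
    · rw [hqt]
      exact (hc _ (hpq.1 η.2) (hi η)).2.2
    · rw [hqt]
      exact (hc _ (hpq.1 η.2) (hi η)).2.1 hη
  have hone : ∀ n l, (1 : ℝ) < f (n + 2) l := fun n l => by
    have : 1 < f (n + 2) l := lt_of_lt_of_le (by norm_num) (hf.three_le n l)
    exact_mod_cast this
  refine addsDominatingReal_of_branches (fun p => p.1.branches) (fun p => p.1.branches_nonempty)
    ?_ (fun x n m => n ≤ m ∧ n < N (FinSeq.ofFun x m) ∧
      (FinSeq.ofFun x m, FinSeq.ofFun x (m + 1)) ∉ (σ (FinSeq.ofFun x m) n).1.val) ?_ ?_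
  · rintro p q (rfl | h)
    · exact subset_rfl
    · exact h.branches_subset
  · rintro ⟨p, hp⟩ n
    obtain ⟨η, hη, hL, hbig⟩ := (hdiv p hp).exists_node (n + 3) n
    have hη' := hbig η hη (FinSeq.Init.refl η)
    have hnode := p.node_eq ⟨η, hη⟩
    dsimp only at hnode
    have hnN : n < N η := by
      have h1 : (f (n + 2) η.len : ℝ) ≤ f (n + 3) η.len := by exact_mod_cast hf.mono _ (by omega)
      have := hN (p.t ⟨η, hη⟩) n
      rw [hnode] at this
      exact this hL (h1.trans hη')
    have hdom : η ∈ (p.t ⟨η, hη⟩).1.dom := by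
      obtain ⟨⟨u, v⟩, huv⟩ := (p.t ⟨η, hη⟩).1.val_nonempty
      exact ⟨v, ((TreeCreature.val_sub _ _ _ huv).1.trans hnode) ▸ huv⟩
    obtain ⟨ν, hν, hν'⟩ := hesc _ (p.t ⟨η, hη⟩) ((hσ _ _ hnN).2.2.trans_le hη') η hdom
    have hνT : ν ∈ (p.t ⟨η, hη⟩).1.pos := ⟨η, hν⟩
    rw [p.pos_eq] at hνT
    obtain ⟨hνT, hlt, hlen⟩ := hνT
    dsimp only at hlt hlen
    obtain ⟨q, hq, hpq, hroot, -⟩ := hshrink p hp ν hνT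
      (fun ρ hρ hi => (hone (n + 1) _).trans_le (hbig ρ hρ (hlt.1.trans hi))) id tendsto_id
    refine ⟨⟨q, hq⟩, Or.inr hpq, η.len, fun x hx => ?_⟩
    have hx' : ∀ x ∈ q.branches, FinSeq.ofFun x ν.len = ν := fun x hx =>
      hroot ▸ TreeCond.ofFun_root_len hx
    have hxη := hlt.1.ofFun_eq (hx' x hx)
    refine ⟨⟨hL, ?_, ?_⟩, fun y hy m hm => ?_⟩
    · rwa [hxη]
    · rw [hxη, ← hlen, hx' x hx]
      exact hν'
    · have hxy := (hx' x hx).trans (hx' y hy).symm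
      rw [FinSeq.ofFun_eq_of_le hxy (by omega : m + 1 ≤ ν.len),
        FinSeq.ofFun_eq_of_le hxy (by omega : m ≤ ν.len)]
      exact id
  · rintro ⟨p, hp⟩ φ
    obtain ⟨h, hh, hφ⟩ := exists_slow_inverse φ
    obtain ⟨η, hη, -, hbig⟩ := (hdiv p hp).exists_node 2 0
    obtain ⟨q, hq, hpq, hroot, hval⟩ := hshrink p hp η hη
      (fun ρ hρ hi => (hone 0 _).trans_le (hbig ρ hρ hi)) h hh
    refine ⟨⟨q, hq⟩, Or.inr hpq, η.len, fun n hn x hx m hm => ?_⟩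
    obtain ⟨hnm, hnN, hmem⟩ := hm
    by_contra hle
    have hhm := hφ n m (not_lt.1 hle)
    have hm : q.root.len ≤ m := by rw [hroot]; omega
    have h1 := hval ⟨_, hx m hm⟩ (hhm.trans_lt hnN)
    exact hmem (hσmono _ _ _ hhm (h1 (TreeCond.mem_val_of_mem_branches hx hm)))

theorem addsDominatingReal_qTreeFast {H : ℕ → Type*} {D : Type*} [∀ i, Nonempty (H i)]
    {f : ℕ → ℕ → ℕ} (hf : IsFast f) (P : TreeCreatingPair H D) (hnorm : P.Normal)
    (hne : Nonempty (QTreeFast P f)) : AddsDominatingReal (QTreeFast P f) := by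
  refine addsDominatingReal_treeForcing hf P hnorm _ (fun p hp x _ n => ?_) ?_ hne
  · obtain ⟨N, hN⟩ := hp n
    exact eventually_atTop.2 ⟨N, fun j hj h => hN ⟨_, h⟩ hj⟩
  · intro p hp q hpq h hh hq n
    obtain ⟨N, hN⟩ := hp (n + 1)
    obtain ⟨M, hM⟩ := eventually_atTop.1 (hh.eventually_ge_atTop (n + 1))
    refine ⟨max N M, fun η hη => ?_⟩
    have h1 := hN ⟨η.1, hpq.1 η.2⟩ ((le_max_left _ _).trans hη)
    have h2 : (f (n + 1) η.1.len : ℝ) ≤ f (h η.1.len) η.1.len := by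
      exact_mod_cast hf.mono _ (hM _ ((le_max_right _ _).trans hη))
    have h3 : (f n η.1.len : ℝ) + 1 ≤ f (n + 1) η.1.len := by exact_mod_cast hf.add_one_le _ _
    linarith [hq η, le_min h1 h2]

/-- Norms that diverge along branches outgrow the fast function `3 ^ n`, which does not depend on
the level. -/
theorem addsDominatingReal_qTreeOne {H : ℕ → Type*} {D : Type*} [∀ i, Nonempty (H i)]
    (P : TreeCreatingPair H D) (hnorm : P.Normal)
    (hne : Nonempty (QTreeOne P)) : AddsDominatingReal (QTreeOne P) := by
  refine addsDominatingReal_treeForcing isFast_three_pow P hnorm _ (fun p hp x hx n => ?_) ?_ hne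
  · have h1 := hp x fun j => hx _ (Nat.le_add_right _ _)
    obtain ⟨M, hM⟩ := eventually_atTop.1 (h1.eventually_ge_atTop (((3 ^ n : ℕ) : ℝ)))
    refine eventually_atTop.2 ⟨p.root.len + M, fun j hj h => ?_⟩
    obtain ⟨i, rfl⟩ := Nat.exists_eq_add_of_le (show p.root.len ≤ j by omega)
    exact hM i (by omega)
  · intro p hp q hpq h hh hq x hx
    have hxq : x ∈ q.branches := fun j hj => by
      have := hx (j - q.root.len)
      rwa [Nat.add_sub_cancel' hj] at this
    have hxp := hpq.branches_subset hxq
    have h1 := hp x fun j => hxp _ (Nat.le_add_right _ _)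
    refine tendsto_atTop.2 fun b => ?_
    obtain ⟨n, hn⟩ := pow_unbounded_of_one_lt (b + 1) (show (1 : ℝ) < 3 by norm_num)
    obtain ⟨M, hM⟩ := eventually_atTop.1 (h1.eventually_ge_atTop (b + 1))
    obtain ⟨M', hM'⟩ := eventually_atTop.1 (hh.eventually_ge_atTop n)
    refine eventually_atTop.2 ⟨p.root.len + M + M', fun j hj => ?_⟩
    have h2 := hq ⟨_, hx j⟩
    have h3 : ∀ l (h : FinSeq.ofFun x l ∈ p.T), p.root.len + M ≤ l →
        b + 1 ≤ (p.t ⟨_, h⟩).1.nor := by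
      intro l h hl
      obtain ⟨i, rfl⟩ := Nat.exists_eq_add_of_le (show p.root.len ≤ l by omega)
      exact hM i (by omega)
    have h4 := h3 (q.root.len + j) (hpq.1 (hx j)) (by omega)
    have h5 : (3 : ℝ) ^ n ≤ 3 ^ h (q.root.len + j) :=
      pow_le_pow_right₀ (by norm_num) (hM' _ (by omega))
    rw [FinSeq.len_ofFun] at h2
    push_cast at h2
    linarith [le_min h4 (hn.le.trans h5)]

/-! ### Gluing, cutting and deciding -/

open Classical in
theorem block_pair {H : ℕ → Type*} {D : Type*} {K : Set (Creature H D)} (t : ℕ → K) (a : ℕ) :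
    block t a (a + 1 + 1) = {t a, t (a + 1)} := by
  ext s
  have hI : ∀ l, l ∈ Finset.Ico a (a + 1 + 1) ↔ l = a ∨ l = a + 1 := fun l => by
    rw [Finset.mem_Ico]
    omega
  simp [block, hI, eq_comm]

namespace CreatureCond

variable {H : ℕ → Type*} {D : Type*} {P : CreatingTriple H D}

/-- If all domains are full, then consecutive creatures make a condition. -/
def ofFull (hfull : P.Full) (w : FinSeq H) (t : ℕ → P.K) (hw : w.len = (t 0).1.dn)
    (hc : ∀ i, (t i).1.up = (t (i + 1)).1.dn) : CreatureCond P where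
  w := w
  t := t
  consec := hc
  w_mem := by
    rw [hfull]
    exact hw
  pos_sub i v hv := by
    rw [hfull]
    exact hv.1.trans (hc i)

/-- Any initial part of the sequence of creatures can be dropped. -/
theorem exists_drop [∀ i, Nonempty (H i)] (p : CreatureCond P) (i : ℕ) :
    ∃ q : CreatureCond P, Relation.ReflTransGen Step p q ∧ ∀ j, q.t j = p.t (i + j) := by
  cases i with
  | zero => exact ⟨p, .refl, fun j => by rw [Nat.zero_add]⟩
  | succ i =>
    obtain ⟨x, hx⟩ := p.branches_nonempty
    exact ⟨p.decided i _ (mem_posSet hx.1 (fun j _ => hx.2 j) (hx.2 i)),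
      .single (p.step_decided i _ _), fun j => rfl⟩

theorem exists_glue (p : CreatureCond P) (hfull : P.Full) {k n₀ : ℕ}
    (hglue : ∀ n ≥ n₀, ∀ t : ℕ → P.K, P.PFC t n →
      ∃ s ∈ P.Sig (block t 0 (n + 1)), (k : ℝ) ≤ s.1.nor ∨ ∃ i ≤ n, (t i).1.nor ≤ s.1.nor)
    {a b : ℕ} (hab : a + n₀ < b) :
    ∃ s ∈ P.Sig (block p.t a b), s.1.dn = (p.t a).1.dn ∧ s.1.up = (p.t b).1.dn ∧
      ((k : ℝ) ≤ s.1.nor ∨ ∃ i, a ≤ i ∧ (p.t i).1.nor ≤ s.1.nor) := by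
  have hpfc : P.PFC (fun j => p.t (a + j)) (b - a - 1) := by
    obtain ⟨⟨u, v⟩, huv⟩ := (p.t (a + 0)).1.val_nonempty
    refine ⟨u, ⟨v, huv⟩, fun i _ => ⟨p.consec (a + i), fun v hv => ?_⟩⟩
    rw [hfull]
    exact hv.1.trans (p.consec (a + i))
  obtain ⟨s, hs, hsn⟩ := hglue _ (by omega) _ hpfc
  have hc : Consecutive (fun j => p.t (a + j)) 0 (b - a - 1 + 1) := fun j _ _ => p.consec (a + j)
  obtain ⟨h1, h2⟩ := P.sig_dn_up _ _ hc s hs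
  rw [block_shift p.t (by omega : a < b)] at hs
  refine ⟨s, hs, h1, ?_, ?_⟩
  · rw [h2, p.consec, show a + (b - a - 1) + 1 = b by omega]
  · rcases hsn with h | ⟨i, -, h⟩
    · exact Or.inl h
    · exact Or.inr ⟨a + i, Nat.le_add_right _ _, h⟩

/-- All creatures of a condition can be glued into blocks so that the norms still diverge.  The
endpoints of the blocks are subject to a prescribed relation `R`. -/
theorem exists_glued (hglue : P.Gluing) (p : CreatureCond P)
    (hp : Tendsto (fun i => (p.t i).1.nor) atTop atTop) (R : ℕ → ℕ → Prop)
    (hR : ∀ i b, ∃ c, b ≤ c ∧ R i c) :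
    ∃ (q : CreatureCond P) (n : ℕ → ℕ), Step p q ∧ n 0 = 0 ∧ StrictMono n ∧
      (∀ j, R (n j) (n (j + 1))) ∧ (∀ j, (q.t j).1.dn = (p.t (n j)).1.dn) ∧
      Tendsto (fun i => (q.t i).1.nor) atTop atTop := by
  obtain ⟨hfull, hglue⟩ := hglue
  choose n₀ hn₀ using hglue
  choose g hg hgR using hR
  let n : ℕ → ℕ := fun j => Nat.rec 0 (fun j i => g i (i + n₀ j + 1)) j
  have hn : ∀ j, n j + n₀ j < n (j + 1) := fun j => hg (n j) (n j + n₀ j + 1)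
  have hmono : StrictMono n := strictMono_nat_of_lt_succ fun j => by
    have := hn j
    omega
  choose t ht hdn hup hnor using fun j => p.exists_glue hfull (hn₀ j) (hn j)
  let q := ofFull hfull p.w t (p.w_len.trans (hdn 0).symm) fun i => (hup i).trans (hdn (i + 1)).symm
  refine ⟨q, n, .compose p q rfl n rfl hmono ht, rfl, hmono, fun j => hgR _ _, hdn, ?_⟩
  refine tendsto_atTop.2 fun b => ?_
  obtain ⟨M, hM⟩ := eventually_atTop.1 (hp.eventually_ge_atTop b)
  obtain ⟨k, hk⟩ := exists_nat_ge b
  refine eventually_atTop.2 ⟨max M k, fun j hj => ?_⟩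
  rcases hnor j with h | ⟨i, hi, h⟩
  · exact (hk.trans (by exact_mod_cast (le_max_right _ _).trans hj)).trans h
  · exact (hM i (((le_max_left _ _).trans hj).trans (hmono.le_apply.trans hi))).trans h

/-- Cutting one creature at `b`. -/
theorem exists_cut (hfull : P.Full) (hcut : P.Cutting) (p : CreatureCond P)
    (hp : Tendsto (fun i => (p.t i).1.nor) atTop atTop) {κ : ℝ} (hκ : 0 < κ)
    (hn : ∀ i, κ + 1 ≤ (p.t i).1.nor) (hd : κ ≤ (p.t 0).1.dn) {b : ℕ} (hb : (p.t 0).1.dn ≤ b) :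
    ∃ q : CreatureCond P, Relation.ReflTransGen Step p q ∧
      Tendsto (fun i => (q.t i).1.nor) atTop atTop ∧ (∀ i, κ ≤ (q.t i).1.nor) ∧
      (q.t 0).1.dn = (p.t 0).1.dn ∧ (∃ j, (q.t j).1.dn = b) ∧
      ∀ i, ∃ j, (q.t j).1.dn = (p.t i).1.dn := by
  obtain ⟨i, hi, hi'⟩ := exists_mem_Ico_of_strictMono p.strictMono_dn hb
  rcases hi.eq_or_lt with hib | hib
  · exact ⟨p, .refl, hp, fun i => (by linarith [hn i]), rfl, ⟨i, hib⟩, fun i => ⟨i, rfl⟩⟩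
  obtain ⟨s₀, s₁, h1, h2, h3, h4, h5, h6, h7⟩ := hcut (p.t i) (by linarith [hn i]) b hib
    (hi'.trans_eq (p.consec i).symm)
  let t : ℕ → P.K := fun j => if j < i then p.t j else if j = i then s₀ else
    if j = i + 1 then s₁ else p.t (j - 1)
  have t_lt : ∀ j, j < i → t j = p.t j := fun j hj => if_pos hj
  have t_i : t i = s₀ := by simp [t]
  have t_i1 : t (i + 1) = s₁ := by simp [t]
  have t_gt : ∀ j, i < j → t (j + 1) = p.t j := fun j hj => by
    simp only [t]
    rw [if_neg (by omega), if_neg (by omega), if_neg (by omega), Nat.add_sub_cancel]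
  have t_dn : ∀ j, j ≤ i → (t j).1.dn = (p.t j).1.dn := fun j hj => by
    rcases hj.lt_or_eq with hj | rfl
    · rw [t_lt j hj]
    · rw [t_i, h1]
  have hκi : κ ≤ min ((p.t i).1.nor - 1) (p.t i).1.dn := by
    refine le_min (by linarith [hn i]) (hd.trans ?_)
    exact_mod_cast p.strictMono_dn.monotone (Nat.zero_le i)
  let q := ofFull hfull p.w t (p.w_len.trans (t_dn 0 (Nat.zero_le _)).symm) (fun j => by
    rcases lt_trichotomy j i with hj | rfl | hj
    · rw [t_lt j hj, t_dn (j + 1) hj, p.consec]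
    · rw [t_i, t_i1, h2, h3]
    · rcases (show i + 1 ≤ j from hj).eq_or_lt with rfl | hj'
      · rw [t_i1, t_gt _ (Nat.lt_succ_self i), h4, p.consec]
      · obtain ⟨j, rfl⟩ := Nat.exists_eq_add_one_of_ne_zero (by omega : j ≠ 0)
        rw [t_gt j (by omega), t_gt (j + 1) (by omega), p.consec])
  have hstep : Step p q := by
    refine .decompose p q rfl (fun j => if j ≤ i then j else j + 1) (by simp)
      (strictMono_nat_of_lt_succ fun j => ?_) fun j => ?_
    · split_ifs <;> omega
    · change block t _ _ ∈ _
      rcases lt_trichotomy j i with hj | rfl | hj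
      · rw [if_pos hj.le, if_pos (by omega), block_succ, t_lt j hj]
        exact P.dec_self _
      · rw [if_pos le_rfl, if_neg (by omega)]
        rw [block_pair, t_i, t_i1]
        exact h7
      · rw [if_neg (by omega), if_neg (by omega), block_succ, t_gt j hj]
        exact P.dec_self _
  refine ⟨q, .single hstep, ?_, fun j => ?_, t_dn 0 (Nat.zero_le _), ⟨i + 1, ?_⟩, fun j => ?_⟩
  · rw [← tendsto_add_atTop_iff_nat 1]
    refine hp.congr' ((eventually_gt_atTop i).mono fun j hj => ?_)
    change _ = (t (j + 1)).1.nor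
    rw [t_gt j hj]
  · change κ ≤ (t j).1.nor
    simp only [t]
    split_ifs
    · linarith [hn j]
    · exact hκi.trans h5
    · exact hκi.trans h6
    · linarith [hn (j - 1)]
  · change (t (i + 1)).1.dn = b
    rw [t_i1, h3]
  · rcases le_or_gt j i with hj | hj
    · exact ⟨j, t_dn j hj⟩
    · refine ⟨j + 1, ?_⟩
      change (t (j + 1)).1.dn = _
      rw [t_gt j hj]

/-- Each of finitely many cuts costs at most `1`. -/
theorem exists_cuts (hfull : P.Full) (hcut : P.Cutting) {κ : ℝ} (hκ : 0 < κ) (B : List ℕ)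
    (p : CreatureCond P) (hp : Tendsto (fun i => (p.t i).1.nor) atTop atTop)
    (hn : ∀ i, κ + B.length ≤ (p.t i).1.nor) (hd : κ + B.length ≤ (p.t 0).1.dn)
    (hB : ∀ b ∈ B, (p.t 0).1.dn ≤ b) :
    ∃ q : CreatureCond P, Relation.ReflTransGen Step p q ∧
      Tendsto (fun i => (q.t i).1.nor) atTop atTop ∧ (∀ i, κ ≤ (q.t i).1.nor) ∧
      (q.t 0).1.dn = (p.t 0).1.dn ∧ (∀ b ∈ B, ∃ j, (q.t j).1.dn = b) ∧
      ∀ i, ∃ j, (q.t j).1.dn = (p.t i).1.dn := by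
  induction B generalizing p with
  | nil => exact ⟨p, .refl, hp, by simpa using hn, rfl, by simp, fun i => ⟨i, rfl⟩⟩
  | cons b B ih =>
    simp only [List.length_cons, Nat.cast_add, Nat.cast_one] at hn hd
    have hlen : (0 : ℝ) ≤ B.length := Nat.cast_nonneg _
    obtain ⟨q, h1, h2, h3, h4, ⟨j, hj⟩, h6⟩ := exists_cut hfull hcut p hp
      (κ := κ + B.length) (by linarith) (fun i => by linarith [hn i]) (by linarith)
      (hB b List.mem_cons_self)
    obtain ⟨r, g1, g2, g3, g4, g5, g6⟩ := ih q h2 h3 (by rw [h4]; linarith)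
      (fun c hc => by rw [h4]; exact hB c (List.mem_cons_of_mem _ hc))
    refine ⟨r, h1.trans g1, g2, g3, g4.trans h4, fun c hc => ?_, fun i => ?_⟩
    · rcases List.mem_cons.1 hc with rfl | hc
      · obtain ⟨l, hl⟩ := g6 j
        exact ⟨l, hl.trans hj⟩
      · exact g5 c hc
    · obtain ⟨l, hl⟩ := h6 i
      obtain ⟨l', hl'⟩ := g6 l
      exact ⟨l', hl'.trans hl⟩

/-- Above any condition there is one whose first creature lives on a given interval `[a, b)` and has
large norm, provided that the interval is long and lies far away.  Cutting at `a`, `a + 1`, …, `b`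
produces sufficiently many pieces for gluing. -/
theorem exists_first [∀ i, Nonempty (H i)] (hglue : P.Gluing) (hcut : P.Cutting)
    (p : CreatureCond P) (hp : Tendsto (fun i => (p.t i).1.nor) atTop atTop) (k : ℕ) :
    ∃ L, ∀ a b, L ≤ a → a + L ≤ b → ∃ r : CreatureCond P, Relation.ReflTransGen Step p r ∧
      Tendsto (fun i => (r.t i).1.nor) atTop atTop ∧ (r.t 0).1.dn = a ∧ (r.t 0).1.up = b ∧
      (k : ℝ) ≤ (r.t 0).1.nor := by
  obtain ⟨hfull, hglue⟩ := hglue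
  obtain ⟨n₀, hn₀⟩ := hglue k
  obtain ⟨M, hM⟩ := eventually_atTop.1 ((hp.eventually_ge_atTop ((k : ℝ) + 1 + (n₀ + 2))).and
    (p.tendsto_dn.eventually_ge_atTop (k + 1 + (n₀ + 2))))
  obtain ⟨p₁, hp₁, ht₁⟩ := p.exists_drop M
  refine ⟨(p₁.t 0).1.dn + n₀ + 1, fun a b ha hb => ?_⟩
  have hBlen : (b :: (List.range (n₀ + 1)).map (a + ·)).length = n₀ + 2 := by simp
  have hp₁' : Tendsto (fun i => (p₁.t i).1.nor) atTop atTop := by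
    simp only [ht₁, add_comm M]
    exact hp.comp (tendsto_add_atTop_nat M)
  obtain ⟨p₂, h1, h2, h3, -, h5, -⟩ := exists_cuts hfull hcut (κ := (k : ℝ) + 1) (by positivity)
    (b :: (List.range (n₀ + 1)).map (a + ·)) p₁ hp₁'
    (fun i => by
      rw [hBlen, ht₁]
      push_cast
      exact (hM _ (by omega)).1)
    (by
      rw [hBlen, ht₁]
      exact_mod_cast (hM _ (by omega)).2)
    (by
      intro c hc
      rcases List.mem_cons.1 hc with rfl | hc
      · omega
      · obtain ⟨l, -, rfl⟩ := List.mem_map.1 hc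
        omega)
  have h6 : ∀ l ≤ n₀, ∃ j, (p₂.t j).1.dn = a + l := fun l hl =>
    h5 _ (List.mem_cons_of_mem _ (List.mem_map.2 ⟨l, List.mem_range.2 (by omega), rfl⟩))
  obtain ⟨i₁, hi₁⟩ := h5 b List.mem_cons_self
  obtain ⟨i₀, hi₀⟩ := h6 0 (Nat.zero_le _)
  have h7 : ∀ l ≤ n₀, ∃ j, (p₂.t j).1.dn = a + l ∧ i₀ + l ≤ j := by
    intro l
    induction l with
    | zero => exact fun _ => ⟨i₀, hi₀, le_rfl⟩
    | succ l ih =>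
      intro hl
      obtain ⟨j, hj, hij⟩ := ih (by omega)
      obtain ⟨j', hj'⟩ := h6 (l + 1) hl
      have : j < j' := p₂.strictMono_dn.lt_iff_lt.1 (by omega)
      exact ⟨j', hj', by omega⟩
  obtain ⟨j, hj, hij⟩ := h7 n₀ le_rfl
  have hlt : j < i₁ := p₂.strictMono_dn.lt_iff_lt.1 (by omega)
  obtain ⟨p₃, hp₃, ht₃⟩ := p₂.exists_drop i₀
  obtain ⟨s, hs, hdn, hup, hsn⟩ := p₃.exists_glue hfull hn₀ (a := 0) (b := i₁ - i₀) (by omega)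
  let t : ℕ → P.K := fun j => Nat.casesOn j s fun j => p₃.t (i₁ - i₀ + j)
  let r := ofFull hfull p₃.w t (p₃.w_len.trans hdn.symm) (fun j => by
    cases j with
    | zero => exact hup
    | succ j => exact p₃.consec _)
  have hstep : Step p₃ r := by
    refine .compose p₃ r rfl (fun j => Nat.casesOn j 0 fun j => i₁ - i₀ + j) rfl
      (strictMono_nat_of_lt_succ fun j => ?_) fun j => ?_
    · cases j with
      | zero => change 0 < i₁ - i₀ + 0; omega
      | succ j => exact Nat.lt_succ_self (i₁ - i₀ + j)
    · cases j with
      | zero => exact hs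
      | succ j =>
        change p₃.t (i₁ - i₀ + j) ∈ P.Sig (block p₃.t (i₁ - i₀ + j) (i₁ - i₀ + j + 1))
        rw [block_succ]
        exact P.sig_self _
  refine ⟨r, (hp₁.trans (h1.trans hp₃)).tail hstep, ?_, ?_, ?_, ?_⟩
  · rw [← tendsto_add_atTop_iff_nat 1]
    change Tendsto (fun j => (p₃.t (i₁ - i₀ + j)).1.nor) atTop atTop
    simp only [ht₃, ← add_assoc, add_comm _ (_ : ℕ)]
    exact h2.comp (tendsto_atTop_mono (fun j => (by simp only [id]; omega)) tendsto_id)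
  · change s.1.dn = a
    rw [hdn, ht₃]
    exact hi₀
  · change s.1.up = b
    rw [hup, ht₃, Nat.add_sub_cancel' (by omega), hi₁]
  · change (k : ℝ) ≤ s.1.nor
    rcases hsn with h | ⟨i, -, h⟩
    · exact h
    · rw [ht₃] at h
      linarith [h3 (i₀ + i)]

/-- Above any condition there is one all of whose creatures begin and end in a given infinite set
`{a 0, a 1, …}`.  First glue so that every creature has some `a m` in its interior, cut every
creature there, and glue again. -/
theorem exists_aligned [∀ i, Nonempty (H i)] (hglue : P.Gluing) (hcut : P.Cutting)
    (p : CreatureCond P) (hp : Tendsto (fun i => (p.t i).1.nor) atTop atTop) {a : ℕ → ℕ}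
    (ha : StrictMono a) :
    ∃ (r : CreatureCond P) (μ : ℕ → ℕ), Relation.ReflTransGen Step p r ∧ StrictMono μ ∧
      (∀ j, (r.t j).1.dn = a (μ j)) ∧ Tendsto (fun i => (r.t i).1.nor) atTop atTop := by
  classical
  obtain ⟨p₁, n, hs₁, -, hn, hR, hdn₁, hp₁⟩ := p.exists_glued hglue hp
    (fun i c => ∃ m, (p.t i).1.dn < a m ∧ a m < (p.t c).1.dn) (fun i b =>
      ⟨b + (a ((p.t i).1.dn + 1) + 1), Nat.le_add_right _ _, (p.t i).1.dn + 1, ha.le_apply,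
        lt_of_lt_of_le (by omega) (p.le_dn _)⟩)
  obtain ⟨M, hM⟩ := eventually_atTop.1 (hp₁.eventually_gt_atTop 1)
  obtain ⟨p₂, hs₂, ht₂⟩ := p₁.exists_drop M
  have hex : ∀ j, ∃ (m : ℕ) (s₀ s₁ : P.K), s₀.1.dn = (p₂.t j).1.dn ∧ s₀.1.up = a m ∧
      s₁.1.dn = a m ∧ s₁.1.up = (p₂.t j).1.up ∧
      min ((p₂.t j).1.nor - 1) (p₂.t j).1.dn ≤ s₀.1.nor ∧
      min ((p₂.t j).1.nor - 1) (p₂.t j).1.dn ≤ s₁.1.nor ∧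
      {s₀, s₁} ∈ P.Dec (p₂.t j) := by
    intro j
    obtain ⟨m, hm, hm'⟩ := hR (M + j)
    obtain ⟨s₀, s₁, h1, h2, h3, h4, h5, h6, h7⟩ := hcut (p₂.t j)
      (by rw [ht₂]; exact hM _ (Nat.le_add_right _ _)) (a m)
      (by rw [ht₂, hdn₁]; exact hm) (by rw [ht₂, p₁.consec, hdn₁]; exact hm')
    exact ⟨m, s₀, s₁, h1, h2, h3, h4, h5, h6, h7⟩
  choose m s₀ s₁ h1 h2 h3 h4 h5 h6 h7 using hex
  let t : ℕ → P.K := fun i => if i % 2 = 0 then s₀ (i / 2) else s₁ (i / 2)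
  have t_even : ∀ j, t (2 * j) = s₀ j := fun j => by simp [t]
  have t_odd : ∀ j, t (2 * j + 1) = s₁ j := fun j => by
    simp only [t]
    rw [if_neg (by omega), show (2 * j + 1) / 2 = j by omega]
  let p₃ := ofFull hglue.1 p₂.w t (p₂.w_len.trans ((t_even 0).symm ▸ (h1 0).symm)) (fun i => by
    obtain ⟨j, rfl | rfl⟩ := Nat.even_or_odd' i
    · rw [t_even, t_odd, h2, h3]
    · rw [t_odd, show 2 * j + 1 + 1 = 2 * (j + 1) by ring, t_even, h1, h4, p₂.consec])
  have hs₃ : Step p₂ p₃ := by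
    refine .decompose p₂ p₃ rfl (fun j => 2 * j) rfl
      (strictMono_nat_of_lt_succ fun j => by omega) fun j => ?_
    change block t (2 * j) (2 * j + 1 + 1) ∈ _
    rw [block_pair, t_even, t_odd]
    exact h7 j
  have hp₃ : Tendsto (fun i => (p₃.t i).1.nor) atTop atTop := by
    refine tendsto_atTop.2 fun b => ?_
    have hp₂ : Tendsto (fun i => (p₂.t i).1.nor) atTop atTop := by
      simp only [ht₂, add_comm M]
      exact hp₁.comp (tendsto_add_atTop_nat M)
    obtain ⟨k, hk⟩ := exists_nat_ge b
    obtain ⟨L, hL⟩ := eventually_atTop.1 ((hp₂.eventually_ge_atTop (b + 1)).and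
      (p₂.tendsto_dn.eventually_ge_atTop k))
    refine eventually_atTop.2 ⟨2 * L, fun i hi => ?_⟩
    have hmin : b ≤ min ((p₂.t (i / 2)).1.nor - 1) (p₂.t (i / 2)).1.dn := by
      obtain ⟨g1, g2⟩ := hL (i / 2) (by omega)
      exact le_min (by linarith) (hk.trans (by exact_mod_cast g2))
    change b ≤ (t i).1.nor
    simp only [t]
    split_ifs
    · exact hmin.trans (h5 _)
    · exact hmin.trans (h6 _)
  -- without its first creature, the condition has its `2 * j`-th creature starting at `a (m j)`
  obtain ⟨p₄, hs₄, ht₄⟩ := p₃.exists_drop 1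
  have hdn₄ : ∀ j, (p₄.t (2 * j)).1.dn = a (m j) := fun j => by
    rw [ht₄, add_comm]
    change (t (2 * j + 1)).1.dn = _
    rw [t_odd, h3]
  have hp₄ : Tendsto (fun i => (p₄.t i).1.nor) atTop atTop := by
    simp only [ht₄, add_comm 1]
    exact hp₃.comp (tendsto_add_atTop_nat 1)
  obtain ⟨r, l, hs₅, hl0, hl, hR', hdn₅, hr⟩ := p₄.exists_glued hglue hp₄ (fun _ c => c % 2 = 0)
    fun _ b => ⟨2 * b, by omega, by omega⟩
  have hleven : ∀ j, l j = 2 * (l j / 2) := fun j => by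
    cases j with
    | zero => simp [hl0]
    | succ j =>
      have := hR' j
      omega
  have hdn : ∀ j, (r.t j).1.dn = a (m (l j / 2)) := fun j => by
    rw [hdn₅, hleven j, hdn₄, ← hleven j]
  refine ⟨r, fun j => m (l j / 2), ((((Relation.ReflTransGen.single hs₁).trans hs₂).tail hs₃).trans
    hs₄).tail hs₅, fun i j hij => ?_, hdn, hr⟩
  refine ha.lt_iff_lt.1 ?_
  rw [← hdn, ← hdn]
  exact r.strictMono_dn hij

end CreatureCond

/-! ### Semi-normal super-gluing triples -/

/-- The chain of small creatures given by semi-normality, indexed by increasing norms, with the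
largest possible length below `m`. -/
theorem CreatingPair.SemiNormal.exists_chain {H : ℕ → Type*} {D : Type*} {P : CreatingPair H D}
    (hP : P.SemiNormal) (m : ℕ) (t : P.K) (hlen : 2 ^ 2 ^ (m + 4) < t.1.up - t.1.dn) :
    ∃ (N : ℕ) (σ : ℕ → P.K),
      (∀ n, n ≤ m → 2 ^ (n + 2) < t.1.nor → n ≤ N) ∧
      (∀ n, (σ n).1.dn = t.1.dn ∧ (σ n).1.up = t.1.up) ∧
      (∀ n n', n ≤ n' → (σ n).1.val ⊆ (σ n').1.val) ∧
      (∀ n, min t.1.nor (2 ^ (n + 2)) ≤ (σ n).1.nor) ∧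
      ∀ n < N, ∀ r : P.K, r.1.dn = t.1.dn → r.1.up = t.1.up → 2 ^ (n + 4) < r.1.nor →
        ∀ u ∈ r.1.dom, ∃ v, (u, v) ∈ r.1.val \ (σ n).1.val := by
  classical
  set Q : ℕ → Prop := fun n => 2 ^ (n + 2) < t.1.nor with hQ
  by_cases h0 : ∃ n ≤ m, Q n
  swap
  · exact ⟨0, fun _ => t, fun n hn h => absurd ⟨n, hn, h⟩ h0, fun _ => ⟨rfl, rfl⟩,
      fun _ _ _ => subset_rfl, fun _ => min_le_left _ _, fun n hn => absurd hn (Nat.not_lt_zero n)⟩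
  obtain ⟨n₁, hn₁, hQn₁⟩ := h0
  have hQN : Q (Nat.findGreatest Q m) := Nat.findGreatest_spec hn₁ hQn₁
  have hNm := Nat.findGreatest_le (P := Q) m
  have hNmax : ∀ n, n ≤ m → Q n → n ≤ Nat.findGreatest Q m := fun n hn h =>
    Nat.le_findGreatest hn h
  generalize Nat.findGreatest Q m = N at hQN hNm hNmax
  obtain ⟨s, hs0, hs⟩ := hP.2 N t hQN (lt_of_le_of_lt
    (Nat.pow_le_pow_right (by norm_num) (Nat.pow_le_pow_right (by norm_num) (by omega))) hlen)
  have hdn : ∀ l ≤ N, (s l).1.dn = t.1.dn ∧ (s l).1.up = t.1.up := by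
    intro l
    induction l with
    | zero => exact fun _ => by rw [hs0]; exact ⟨rfl, rfl⟩
    | succ l ih =>
      intro hl
      obtain ⟨h1, h2, -⟩ := CreatingPair.sig_single (hs l hl).1
      exact ⟨h1.trans (ih (by omega)).1, h2.trans (ih (by omega)).2⟩
  have hmono : ∀ l l', l ≤ l' → l' ≤ N → (s l').1.val ⊆ (s l).1.val := by
    intro l l' hl
    induction l', hl using Nat.le_induction with
    | base => exact fun _ => subset_rfl
    | succ l' _ ih => exact fun h =>
        (CreatingPair.sig_single (hs l' h).1).2.2.2.trans (ih (by omega))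
  refine ⟨N, fun n => s (N - n), hNmax, fun n => hdn _ (by omega),
    fun n n' h => hmono _ _ (by omega) (by omega), fun n => ?_, fun n hn => ?_⟩
  · rcases lt_or_ge n N with hn | hn
    · have h1 := (hs (N - n - 1) (by omega)).2.1
      rw [show N - n - 1 + 1 = N - n by omega, show N + 1 - (N - n - 1) = n + 2 by omega] at h1
      exact (min_le_right _ _).trans h1.le
    · dsimp only
      rw [Nat.sub_eq_zero_of_le hn, hs0]
      exact min_le_left _ _
  · have h1 := (hs (N - n - 1) (by omega)).2.2.2
    rwa [show N - n - 1 + 1 = N - n by omega, show N + 3 - (N - n - 1) = n + 4 by omega] at h1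

/-- Here the levels are the intervals of a fixed partition, on each of which semi-normality provides a
chain of small creatures.  A condition is first aligned with the partition; super-gluing then
combines the small creatures inside the interval of one of its creatures into a single creature, with
which it can be linked. -/
theorem addsDominatingReal_qInfty {H : ℕ → Type*} {D : Type*} [∀ i, Nonempty (H i)]
    (P : CreatingTriple H D) (hsemi : P.SemiNormal) (hsuper : P.SuperGluing) (hcut : P.Cutting)
    (hne : Nonempty (QInfty P)) : AddsDominatingReal (QInfty P) := by
  obtain ⟨⟨p₀, hp₀⟩⟩ := hne
  obtain ⟨hglue, hsuper⟩ := hsuper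
  obtain ⟨q₀, n₀, -, -, hn₀, hR₀, hdn₀, hq₀⟩ := p₀.exists_glued hglue hp₀
    (fun i c => 2 ^ 2 ^ (i + 4) < c - i)
    (fun i b => by
      generalize 2 ^ 2 ^ (i + 4) = e
      exact ⟨b + i + e + 1, by omega, by omega⟩)
  have hlong : ∀ m, 2 ^ 2 ^ (m + 4) < (q₀.t m).1.up - (q₀.t m).1.dn := by
    intro m
    rw [q₀.consec, hdn₀, hdn₀]
    have h1 := p₀.add_dn_le (hn₀ (Nat.lt_succ_self m)).le
    have h2 := hR₀ m
    have h3 : 2 ^ 2 ^ (m + 4) ≤ 2 ^ 2 ^ (n₀ m + 4) :=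
      Nat.pow_le_pow_right (by norm_num)
        (Nat.pow_le_pow_right (by norm_num) (Nat.add_le_add_right hn₀.le_apply 4))
    rw [Nat.succ_eq_add_one] at h1
    omega
  choose N σ hN hσ hσmono hσnor hesc using fun m => hsemi.exists_chain m (q₀.t m) (hlong m)
  set a : ℕ → ℕ := fun m => (q₀.t m).1.dn with ha
  have ha_mono : StrictMono a := q₀.strictMono_dn
  have hσup : ∀ m n, (σ m n).1.up = a (m + 1) := fun m n => ((hσ m n).2).trans (q₀.consec m)
  refine addsDominatingReal_of_branches (fun p => p.1.branches) (fun p => p.1.branches_nonempty)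
    (fun p q hpq => CreatureCond.branches_subset_of_reflTransGen hpq)
    (fun x n m => n ≤ m ∧ n < N m ∧ ¬ (σ m n).1.Through x) ?_ ?_
  · rintro ⟨p, hp⟩ n
    obtain ⟨L, hL⟩ := p.exists_first hglue hcut hp (2 ^ (n + 4) + 1)
    obtain ⟨m, hm, hm'⟩ := ((eventually_ge_atTop (L + n + 1)).and
      (hq₀.eventually_gt_atTop (2 ^ (n + 1 + 2)))).exists
    have hmL : m < 2 ^ 2 ^ (m + 4) :=
      (by omega : m ≤ m + 4).trans_lt (Nat.lt_two_pow_self.trans Nat.lt_two_pow_self)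
    have hlong_m := hlong m
    rw [q₀.consec] at hlong_m
    have hlong_m : 2 ^ 2 ^ (m + 4) < a (m + 1) - a m := hlong_m
    obtain ⟨r, hpr, hr, hdn, hup, hnor⟩ := hL (a m) (a (m + 1))
      ((by omega : L ≤ m).trans ha_mono.le_apply) (by omega)
    have hnN : n < N m := hN m (n + 1) (by omega) hm'
    obtain ⟨x, hx⟩ := r.branches_nonempty
    obtain ⟨v, hv, hv'⟩ := hesc m n hnN (r.t 0) hdn (hup.trans (q₀.consec m).symm)
      (by push_cast at hnor; linarith) _ (hx.2 0).mem_dom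
    have hvlen : v.len = a (m + 1) := ((r.t 0).1.val_sub _ _ hv).2.1.trans hup
    have hpos := CreatureCond.mem_posSet hx.1 (fun j _ => hx.2 j) hv
    refine ⟨⟨r.decided 0 v hpos, ?_⟩, hpr.tail (r.step_decided 0 v hpos), m,
      fun y hy => ⟨⟨by omega, hnN, ?_⟩, fun z hz l hl => ?_⟩⟩
    · exact (hr.comp (tendsto_add_atTop_nat 1)).congr fun j => by
        simp [CreatureCond.decided, add_comm]
    · have hyv : FinSeq.ofFun y v.len = v := hy.1
      rw [Creature.Through, (hσ m n).1, hσup, ← hvlen, hyv]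
      have h1 := (Creature.through_of_mem_val hv hyv).2
      rw [hdn] at h1
      have h2 : FinSeq.ofFun y (q₀.t m).1.dn = FinSeq.ofFun x (r.t 0).1.dn := by
        rw [hdn]
        exact h1
      rw [h2]
      exact hv'
    · have hyz : FinSeq.ofFun z v.len = FinSeq.ofFun y v.len := hz.1.trans hy.1.symm
      refine fun h => ⟨h.1, h.2.1, fun h' => h.2.2 (h'.congr ?_ hyz)⟩
      rw [hσup, hvlen]
      exact ha_mono.monotone (by omega)
  · rintro ⟨p, hp⟩ φ
    obtain ⟨h, hh, hφ⟩ := exists_slow_inverse φ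
    obtain ⟨r, μ, hpr, hμ, hdn, hr⟩ := p.exists_aligned hglue hcut hp ha_mono
    have hup : ∀ j, (r.t j).1.up = a (μ (j + 1)) := fun j => (r.consec j).trans (hdn _)
    -- on the interval of each creature, the small creatures are combined into `S j`
    have hS : ∀ j, ∃ S : P.K, S.1.dn = (r.t j).1.dn ∧ S.1.up = (r.t j).1.up ∧
        (∃ m, μ j ≤ m ∧ (σ m (h m)).1.nor - 1 ≤ S.1.nor) ∧
        ∀ u v, (u, v) ∈ S.1.val → ∀ m, μ j ≤ m → m < μ (j + 1) → (σ m (h m)).1.Allows v := by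
      intro j
      have hj := hμ (Nat.lt_succ_self j)
      rw [Nat.succ_eq_add_one] at hj
      obtain ⟨S, h1, h2, -, ⟨i, -, h3⟩, h4⟩ := hsuper (μ (j + 1) - μ j - 1)
        (fun i => σ (μ j + i) (h (μ j + i))) (a (μ (j + 1)))
        (fun i _ => by rw [hσup, (hσ _ _).1]; exact le_rfl)
        (by rw [hσup, show μ j + (μ (j + 1) - μ j - 1) + 1 = μ (j + 1) by omega])
      refine ⟨S, h1.trans ?_, h2.trans (hup j).symm, ⟨_, Nat.le_add_right _ _, h3⟩,
        fun u v huv m hm hm' => ?_⟩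
      · rw [(hσ _ _).1, hdn]
        rfl
      · have := h4 u v huv (m - μ j) (by omega)
        rwa [Nat.add_sub_cancel' hm] at this
    choose S hSdn hSup hSnor hSval using hS
    have hSlim : Tendsto (fun j => (S j).1.nor) atTop atTop := by
      refine tendsto_atTop.2 fun b => ?_
      obtain ⟨k, hk⟩ := pow_unbounded_of_one_lt (b + 1) (show (1 : ℝ) < 2 by norm_num)
      obtain ⟨M, hM⟩ := eventually_atTop.1 ((hq₀.eventually_ge_atTop (b + 1)).and
        (hh.eventually_ge_atTop k))
      refine eventually_atTop.2 ⟨M, fun j hj => ?_⟩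
      obtain ⟨m, hm, hmS⟩ := hSnor j
      obtain ⟨h1, h2⟩ := hM m (hj.trans (hμ.le_apply.trans hm))
      have h3 : (2 : ℝ) ^ k ≤ 2 ^ (h m + 2) := pow_le_pow_right₀ (by norm_num) (by omega)
      linarith [hσnor m (h m), le_min h1 (hk.le.trans h3)]
    have hex : ∀ j, ∃ s ∈ P.Sig {r.t j}, (1 < (r.t j).1.nor → 1 < (S j).1.nor →
        s ∈ P.Sig {S j}) ∧ min (r.t j).1.nor (S j).1.nor - 1 ≤ s.1.nor := by
      intro j
      by_cases hc : 1 < (r.t j).1.nor ∧ 1 < (S j).1.nor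
      · obtain ⟨s, hs, hsn⟩ := hsemi.1 (r.t j) (S j) hc.1 hc.2 (hSdn j).symm (hSup j).symm
        exact ⟨s, hs.1, fun _ _ => hs.2, hsn⟩
      · refine ⟨r.t j, P.sig_self _, fun h1 h2 => absurd ⟨h1, h2⟩ hc, ?_⟩
        linarith [min_le_left (r.t j).1.nor (S j).1.nor]
    choose t ht ht' htn using hex
    obtain ⟨q, hq, hrq⟩ := r.exists_shrink t ht
    obtain ⟨j₀, hj₀⟩ := eventually_atTop.1
      ((hr.eventually_gt_atTop 1).and (hSlim.eventually_gt_atTop 1))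
    refine ⟨⟨q, ?_⟩, hpr.tail hrq, μ j₀, fun n hn x hx m hm => ?_⟩
    · change Tendsto (fun j => (q.t j).1.nor) atTop atTop
      rw [hq]
      refine tendsto_atTop.2 fun b => ?_
      filter_upwards [hr.eventually_ge_atTop (b + 1), hSlim.eventually_ge_atTop (b + 1)]
        with j h1 h2
      linarith [htn j, le_min h1 h2]
    · obtain ⟨hnm, hnN, hmem⟩ := hm
      by_contra hle
      have hhm := hφ n m (not_lt.1 hle)
      have h0 : μ 0 ≤ μ j₀ := hμ.monotone (Nat.zero_le _)
      obtain ⟨j, hj, hj'⟩ := exists_mem_Ico_of_strictMono hμ (by omega : μ 0 ≤ m)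
      have hjj : j₀ ≤ j := Nat.lt_succ_iff.1 (hμ.lt_iff_lt.1 (by rw [Nat.succ_eq_add_one]; omega))
      have h1 := CreatingPair.sig_single (ht' j (hj₀ j hjj).1 (hj₀ j hjj).2)
      have h2 : (t j).1.Through x := hq ▸ hx.2 j
      have h3 := (hSval j _ _ (h1.2.2.2 h2) m hj hj').through
      have h4 := hσmono m _ _ hhm h3
      refine hmem ?_
      rw [Creature.Through, (hσ _ _).1, (hσ _ _).2]
      rwa [(hσ _ _).1, (hσ _ _).2] at h4

theorem mainTheorem2 {H : ℕ → Type*} {D : Type*}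
    [∀ i, Countable (H i)] [∀ i, Nontrivial (H i)] :
    (∀ f : ℕ → ℕ → ℕ, IsFast f →
      (∀ P : CreatingPair H D, P.Local → P.Normal → Nonempty (QFast P f) →
        AddsDominatingReal (QFast P f)) ∧
      (∀ P : TreeCreatingPair H D, P.Normal → Nonempty (QTreeFast P f) →
        AddsDominatingReal (QTreeFast P f))) ∧
    (∀ P : TreeCreatingPair H D, P.Normal → Nonempty (QTreeOne P) →
      AddsDominatingReal (QTreeOne P)) ∧
    (∀ P : CreatingTriple H D, P.SemiNormal → P.SuperGluing → P.Cutting →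
      Nonempty (QInfty P) → AddsDominatingReal (QInfty P)) := by
  refine ⟨fun f hf => ⟨fun P hloc hnorm hne => ?_, fun P hnorm hne => ?_⟩, fun P hnorm hne => ?_,
    fun P hsemi hsuper hcut hne => ?_⟩
  · exact addsDominatingReal_qFast hf P hloc hnorm hne
  · exact addsDominatingReal_qTreeFast hf P hnorm hne
  · exact addsDominatingReal_qTreeOne P hnorm hne
  · exact addsDominatingReal_qInfty P hsemi hsuper hcut hne
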